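/- Let $G$ be a finite-dimensional real (Hausdorff, $C^\infty$) Lie group with Lie algebra $\mathfrak g=T_eG$ (bracket of left-invariant vector fields), and let $\mathfrak g=\mathfrak z\oplus\mathfrak p$, where $\mathfrak z$ is the center of $\mathfrak g$ and $\mathfrak p$ is a linear complement. Fix an ordered basis of $\mathfrak g$ consisting of a basis $\{e_\mu\}_{\mu=1}^{r}$ of $\mathfrak z$ and a basis $\{e_a\}_{a=1}^{s}$ of $\mathfrak p$. Indices $i,j,k$ run over all $r+s$ basis elements, $\mu$ over the central ones, $a,b$ over those of $\mathfrak p$; products over an index are ordered increasingly. For a coordinate tuple $x=(x^\mu,x^a)\in\mathbb R^{r+s}$ put $$g_x=\prod_{\mu=1}^{r}\exp(x^\mu e_\mu)\prod_{a=1}^{s}\exp(x^a e_a).$$ Let $U$ be an open neighbourhood of $0$ on which $x\mapsto g_x$ is a smooth diffeomorphism onto an open neighbourhood $G_e$ of the identity (second canonical coordinates). Let $\Phi$ be the composition function, $g_xg_y=g_{\Phi(x,y)}$ for $x,y\in U$ with $g_xg_y\in G_e$; let $\xi^j_i(x)=\partial\Phi^j(x,y)/\partial y^i|_{y=0}$ be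 the components of the left-invariant vector fields and $(\omega^i_j(x))=(\xi^i_j(x))^{-1}$ those of the dual left-invariant 1-forms. Write $\|\mathrm{ad}\,e_a\|$ for the matrix of $\mathrm{ad}\,e_a$ in the basis. **(1)** For every $x\in U$ the matrix $\xi(x)$ is invertible, and $\omega(x)$ is given by matrix exponentials depending only on the coordinates $x^a$: $\omega^i_\mu(x)=\delta^i_\mu$ and $$\omega^i_a(x)=\big\|\exp(-x^{s}\mathrm{ad}\,e_{s})\exp(-x^{s-1}\mathrm{ad}\,e_{s-1})\cdots\exp(-x^{a+1}\mathrm{ad}\,e_{a+1})\big\|^i_a .$$ **(2)** There are $\varepsilon>0$ and smooth functions $\bar\Phi=(\bar\Phi^a)$ and $\Theta=(\Theta^\mu)$ of two $\mathfrak p$-tuples $u,v\in B=\{u\in\mathbb R^s:\max_a|u^a|<\varepsilon\}$ such that every $x,y\in\mathbb R^{r+s}$ with all coordinates smaller than $\varepsilon$ in absolute value lie in $U$, satisfy $g_xg_y\in G_e$, and (with $\bar\Phi$ and $\Theta$ evaluated at the $\mathfrak p$-parts of $x$ and $y$) $$\Phi^a(x,y)=\bar\Phi^a,\qquad \Phi^\mu(x,y)=x^\mu+y^\mu+\Theta^\mu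 .$$ For all $u,v\in B$ one has $(0,\bar\Phi(u,v))\in U$ and $$\prod_a\exp(u^ae_a)\prod_b\exp(v^be_b)=\prod_\mu\exp(\Theta^\mu(u,v)e_\mu)\prod_a\exp(\bar\Phi^a(u,v)e_a).$$ **(3)** The functions $\bar\Phi^a$ are determined algebraically by the adjoint matrices: there is an open set $W\supseteq B$ in $\mathbb R^s$ on which $w\mapsto\prod_a\exp(w^a\|\mathrm{ad}\,e_a\|)$ is injective, and for all $u,v\in B$ the tuple $\bar\Phi(u,v)$ lies in $W$ and is hence the unique $w\in W$ with $$\prod_a\exp(u^a\|\mathrm{ad}\,e_a\|)\prod_b\exp(v^b\|\mathrm{ad}\,e_b\|)=\prod_a\exp(w^a\|\mathrm{ad}\,e_a\|).$$ **(4)** The functions $\Theta^\mu$ are given by quadratures: for every $u\in B$ and every $\mu$ the 1-form $$\sum_{a,j}\xi^\mu_j(0,\bar\Phi(u,z))\,\omega^j_a(0,z)\,dz^a$$ in $z\in B$ is smooth and closed, it is the differential of $z\mapsto\Theta^\mu(u,z)$, and for every $v\in B$ $$\Theta^\mu(u,v)=\int_0^v\sum_{a,j}\xi^\mu_j(0,\bar\Phi(u,z))\,\omega^j_a(0,z)\,dz^a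 ,$$ the integral being taken along any $C^1$ path in $B$ from $0$ to $v$. -/

import Mathlib

open scoped Manifold ContDiff

namespace LocalLieGroup

noncomputable section

section Group

variable {E : Type*} [NormedAddCommGroup E] [NormedSpace ℝ E]
  {G : Type*} [TopologicalSpace G] [ChartedSpace E G] [Group G]

/-- A smooth real Lie group has the regularity for which Mathlib equips its tangent space at the
identity with the structure of a Lie algebra. -/
instance instLieGroupMinSmoothness [LieGroup 𝓘(ℝ, E) ∞ G] :
    LieGroup 𝓘(ℝ, E) (minSmoothness ℝ 3) G :=
  LieGroup.of_le (n := ∞) (by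
    rw [minSmoothness_of_isRCLikeNormedField]
    exact ENat.LEInfty.out)

/-- The exponential map of a Lie group: `lieExp X` is the value at time `1` of the integral curve
through the identity of the left-invariant vector field generated by `X`. -/
def lieExp (X : GroupLieAlgebra 𝓘(ℝ, E) G) : G :=
  Classical.epsilon
    (fun γ : ℝ → G =>
      γ 0 = 1 ∧ IsMIntegralCurve (I := 𝓘(ℝ, E)) γ (fun g => mulInvariantVectorField X g)) 1

variable {r s : ℕ}

/-- The ordered product `exp(c¹ e₁) ⋯ exp(cʳ e_r)` over the first block of the basis. -/
def centralProd (e : Module.Basis (Fin r ⊕ Fin s) ℝ (GroupLieAlgebra 𝓘(ℝ, E) G))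
    (c : Fin r → ℝ) : G :=
  (List.ofFn fun μ : Fin r => lieExp (c μ • e (Sum.inl μ))).prod

/-- The ordered product `exp(u¹ e₁) ⋯ exp(uˢ e_s)` over the second block of the basis. -/
def complProd (e : Module.Basis (Fin r ⊕ Fin s) ℝ (GroupLieAlgebra 𝓘(ℝ, E) G))
    (u : Fin s → ℝ) : G :=
  (List.ofFn fun a : Fin s => lieExp (u a • e (Sum.inr a))).prod

/-- `φ` is the inverse `x ↦ g_x` of a system of second canonical coordinates for the basis `e`: a
smooth diffeomorphism from an open neighbourhood `φ.source` of `0` onto an open neighbourhood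
`φ.target` of the identity, given by
`g_x = exp(x^μ¹ e_μ¹) ⋯ exp(x^μʳ e_μʳ) exp(x^a¹ e_a¹) ⋯ exp(x^aˢ e_aˢ)`. -/
structure IsSecondCanonical
    (e : Module.Basis (Fin r ⊕ Fin s) ℝ (GroupLieAlgebra 𝓘(ℝ, E) G))
    (φ : OpenPartialHomeomorph (Fin r ⊕ Fin s → ℝ) G) : Prop where
  zero_mem : 0 ∈ φ.source
  eq_prod : ∀ x ∈ φ.source,
    φ x = centralProd e (fun μ => x (Sum.inl μ)) * complProd e (fun a => x (Sum.inr a))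
  smooth : ContMDiffOn 𝓘(ℝ, Fin r ⊕ Fin s → ℝ) 𝓘(ℝ, E) ∞ φ φ.source
  smooth_symm : ContMDiffOn 𝓘(ℝ, E) 𝓘(ℝ, Fin r ⊕ Fin s → ℝ) ∞ φ.symm φ.target

/-- The composition function: `g_x g_y = g_{Φ(x,y)}` whenever `x, y` are in the coordinate domain
and `g_x g_y` is in the coordinate neighbourhood `φ.target`. -/
def compFun (φ : OpenPartialHomeomorph (Fin r ⊕ Fin s → ℝ) G) (x y : Fin r ⊕ Fin s → ℝ) :
    Fin r ⊕ Fin s → ℝ :=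
  φ.symm (φ x * φ y)

/-- The matrix `ξ(x)` of components of the left-invariant vector fields: its entry in row `j` and
column `i` is `ξ^j_i(x) = ∂Φ^j(x,y)/∂y^i` at `y = 0`. -/
def leftField (φ : OpenPartialHomeomorph (Fin r ⊕ Fin s → ℝ) G) (x : Fin r ⊕ Fin s → ℝ) :
    Matrix (Fin r ⊕ Fin s) (Fin r ⊕ Fin s) ℝ :=
  Matrix.of fun j i => fderiv ℝ (fun y => compFun φ x y) 0 (Pi.single i 1) j

/-- The matrix `ω(x) = ξ(x)⁻¹` of components `ω^i_j(x)` (row `i`, column `j`) of the left-invariant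
1-forms `ω^i = ω^i_j(x) dx^j` dual to the left-invariant vector fields. -/
def leftForm (φ : OpenPartialHomeomorph (Fin r ⊕ Fin s → ℝ) G) (x : Fin r ⊕ Fin s → ℝ) :
    Matrix (Fin r ⊕ Fin s) (Fin r ⊕ Fin s) ℝ :=
  (leftField φ x)⁻¹

/-- The coordinate tuple with vanishing central part and second block `u`. -/
def ofCompl (u : Fin s → ℝ) : Fin r ⊕ Fin s → ℝ :=
  Sum.elim 0 u

/-- The 1-form `ξ^μ_j(w(v)) ω^j_a(v) dv^a` in the variable `v` (sum over all `j` and over the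
complementary indices `a`), where `w` is a map between the spaces of complementary coordinates. -/
def quadratureForm (φ : OpenPartialHomeomorph (Fin r ⊕ Fin s → ℝ) G)
    (w : (Fin s → ℝ) → (Fin s → ℝ)) (μ : Fin r) (v : Fin s → ℝ) : (Fin s → ℝ) →L[ℝ] ℝ :=
  ∑ a : Fin s,
    (∑ j, leftField φ (ofCompl (w v)) (Sum.inl μ) j * leftForm φ (ofCompl v) j (Sum.inr a)) •
      ContinuousLinearMap.proj (R := ℝ) (φ := fun _ : Fin s => ℝ) a

end Group

section Adjoint

variable {L : Type*} [LieRing L] [LieAlgebra ℝ L] {r s : ℕ}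

/-- The matrix of `ad e_i` in the basis `e`. -/
def adMatrix (e : Module.Basis (Fin r ⊕ Fin s) ℝ L) (i : Fin r ⊕ Fin s) :
    Matrix (Fin r ⊕ Fin s) (Fin r ⊕ Fin s) ℝ :=
  LinearMap.toMatrix e e (LieAlgebra.ad ℝ L (e i))

/-- The ordered matrix product `exp(u¹ ad e₁) ⋯ exp(uˢ ad e_s)` over the second block. -/
def adProd (e : Module.Basis (Fin r ⊕ Fin s) ℝ L) (u : Fin s → ℝ) :
    Matrix (Fin r ⊕ Fin s) (Fin r ⊕ Fin s) ℝ :=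
  (List.ofFn fun a : Fin s => NormedSpace.exp (u a • adMatrix e (Sum.inr a))).prod

/-- The ordered matrix product `exp(-uˢ ad e_s) exp(-uˢ⁻¹ ad e_{s-1}) ⋯ exp(-uᵃ⁺¹ ad e_{a+1})` over
the indices of the second block that are larger than `a`, in decreasing order. -/
def adTail (e : Module.Basis (Fin r ⊕ Fin s) ℝ L) (u : Fin s → ℝ) (a : Fin s) :
    Matrix (Fin r ⊕ Fin s) (Fin r ⊕ Fin s) ℝ :=
  (List.ofFn fun c : Fin s =>
    if a < c then NormedSpace.exp (-(u c) • adMatrix e (Sum.inr c)) else 1).reverse.prod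

/-- The matrix whose column with a central index `μ` is the unit column, and whose column with a
complementary index `a` is the column `a` of `adTail e u a`. -/
def adForm (e : Module.Basis (Fin r ⊕ Fin s) ℝ L) (u : Fin s → ℝ) :
    Matrix (Fin r ⊕ Fin s) (Fin r ⊕ Fin s) ℝ :=
  Matrix.of fun i k => Sum.elim
    (fun μ => (1 : Matrix (Fin r ⊕ Fin s) (Fin r ⊕ Fin s) ℝ) i (Sum.inl μ))
    (fun a => adTail e u a i (Sum.inr a)) k

end Adjoint

/-- The 1-form `α` is smooth and closed on the open set `V`. -/
def IsSmoothClosedOn {s : ℕ} (α : (Fin s → ℝ) → (Fin s → ℝ) →L[ℝ] ℝ) (V : Set (Fin s → ℝ)) :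
    Prop :=
  ContDiffOn ℝ ∞ α V ∧ ∀ v ∈ V, ∀ p q, fderiv ℝ α v p q = fderiv ℝ α v q p

end

end LocalLieGroup

/-!
The proof works in a chart `φ` centred at the identity (`IsCentredChart`), where products,
translations and conjugations of group elements are smooth maps between normed spaces. The adjoint
representation `Ad` becomes `adCoord φ`, the derivative at `0` of `y ↦ φ.symm (g * φ y * g⁻¹)`.

*The adjoint representation of an exponential.* Left-invariant fields are complete, so
`t ↦ lieExp (t • X)` is a one-parameter subgroup. Differentiating the identity `(x y x⁻¹) x = x y`
first in `y` and then in `x` shows that the differential of `Ad` at the identity is the bracket of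
the left-invariant fields (`hasFDerivAt_adCoord`, `toCoord_lie`); hence `t ↦ Ad (lieExp (t • X))`
solves the same linear differential equation as `exp (t ad X)`, and both agree (`adCoord_lieExp`).
By uniqueness of integral curves, conjugation by `g` maps `lieExp (t • X)` to
`lieExp (t • Ad g X)` (`conj_lieExp`). In particular the exponential of a central element commutes
with all exponentials and has a trivial adjoint representation.

*The left-invariant forms.* The translation `φ(x)⁻¹ φ(y)` has a derivative at `y = x` that is
inverse to `ξ(x)`. If only the `i`-th coordinate of `x` changes, then `φ(x)` is multiplied on the
right by `T⁻¹ lieExp (t • e i) T`, where `T` is the product of the factors of `φ(x)` behind the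
`i`-th one. So the `i`-th column of `ω(x)` is `Ad(T⁻¹) e i`, a product of matrix exponentials
applied to a unit vector (`leftFormCoord_single`, `leftForm_eq`).

*The composition function.* Since the central factors can be collected on the left, `Φ(x, y)` is the
sum of the central parts and of `Φ` at the complementary parts (`compFun_eq`); so `Φbar` and `Θ` are
the components of `Φ` at pairs with vanishing central part. Applying `Ad` to the product identity in
the group removes the central factor and gives the identity between matrix exponentials. The
differential of `u ↦ adProd e u` at `0` is `u ↦ ad (∑ uᵃ e a)`, which is injective because the
complement meets the center trivially, so `adProd e` is injective near `0`
(`exists_nhds_injOn_adProd`). Finally `∂Φ/∂y (x, y) = ξ(Φ(x, y)) ω(y)` by left-invariance, and `ξ`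
does not depend on the central coordinates, so the 1-form of the quadrature is the differential of
`Θ` (`hasFDerivAt_compFun`). It is therefore closed and integrates to `Θ` along every path.
-/

namespace LocalLieGroup

open Set Filter Topology

noncomputable section

/-! ### Coordinates centred at the identity -/

section

variable {E : Type*} [NormedAddCommGroup E] [NormedSpace ℝ E]
  {G : Type*} [TopologicalSpace G] [ChartedSpace E G] [Group G]
  {V : Type*} [NormedAddCommGroup V] [NormedSpace ℝ V]

/-- `φ` is the inverse of a smooth coordinate system of the Lie group `G`, centred at the identity
and with values in the normed space `V`. -/
structure IsCentredChart (φ : OpenPartialHomeomorph V G) : Prop where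
  zero_mem : 0 ∈ φ.source
  map_zero : φ 0 = 1
  smooth : ContMDiffOn 𝓘(ℝ, V) 𝓘(ℝ, E) ∞ φ φ.source
  smooth_symm : ContMDiffOn 𝓘(ℝ, E) 𝓘(ℝ, V) ∞ φ.symm φ.target

/-- The adjoint representation in the coordinates `φ`: the derivative at `0` of the conjugation by
`g`. -/
def adCoord (φ : OpenPartialHomeomorph V G) (g : G) : V →L[ℝ] V :=
  fderiv ℝ (fun y => φ.symm (g * φ y * g⁻¹)) 0

/-- The derivative at the identity of the left translation by `φ x`, in the coordinates `φ`. -/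
def leftCoord (φ : OpenPartialHomeomorph V G) (x : V) : V →L[ℝ] V :=
  fderiv ℝ (fun y => φ.symm (φ x * φ y)) 0

/-- The Maurer–Cartan form at `φ x`, in the coordinates `φ`: the derivative at `x` of the left
translation by `(φ x)⁻¹`. -/
def leftFormCoord (φ : OpenPartialHomeomorph V G) (x : V) : V →L[ℝ] V :=
  fderiv ℝ (fun y => φ.symm ((φ x)⁻¹ * φ y)) x

namespace IsCentredChart

variable {φ : OpenPartialHomeomorph V G} (h : IsCentredChart (E := E) φ)
include h

theorem one_mem : (1 : G) ∈ φ.target := h.map_zero ▸ φ.map_source h.zero_mem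

theorem symm_one : φ.symm 1 = 0 := by
  rw [← h.map_zero, φ.left_inv h.zero_mem]

theorem contMDiffAt {x : V} (hx : x ∈ φ.source) : ContMDiffAt 𝓘(ℝ, V) 𝓘(ℝ, E) ∞ φ x :=
  h.smooth.contMDiffAt (φ.open_source.mem_nhds hx)

theorem contMDiffAt_symm {g : G} (hg : g ∈ φ.target) :
    ContMDiffAt 𝓘(ℝ, E) 𝓘(ℝ, V) ∞ φ.symm g :=
  h.smooth_symm.contMDiffAt (φ.open_target.mem_nhds hg)

theorem contDiffAt_symm_comp {N : Type*} [NormedAddCommGroup N] [NormedSpace ℝ N] {f : N → G}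
    {p : N} (hf : ContMDiffAt 𝓘(ℝ, N) 𝓘(ℝ, E) ∞ f p) (hp : f p ∈ φ.target) :
    ContDiffAt ℝ ∞ (fun q => φ.symm (f q)) p :=
  ((h.contMDiffAt_symm hp).comp p hf).contDiffAt

variable [LieGroup 𝓘(ℝ, E) ∞ G]

/-- Products of group elements are smooth in coordinates. -/
theorem contDiffAt_mul {x y : V} (hx : x ∈ φ.source) (hy : y ∈ φ.source)
    (hxy : φ x * φ y ∈ φ.target) :
    ContDiffAt ℝ ∞ (fun p : V × V => φ.symm (φ p.1 * φ p.2)) (x, y) :=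
  h.contDiffAt_symm_comp
    ((ContMDiffAt.comp (x, y) (h.contMDiffAt (x := x) hx) contDiff_fst.contMDiff.contMDiffAt).mul
      (ContMDiffAt.comp (x, y) (h.contMDiffAt (x := y) hy) contDiff_snd.contMDiff.contMDiffAt)) hxy

theorem contDiffAt_translate {g k : G} {x : V} (hx : x ∈ φ.source)
    (hgk : g * φ x * k ∈ φ.target) :
    ContDiffAt ℝ ∞ (fun y => φ.symm (g * φ y * k)) x :=
  h.contDiffAt_symm_comp
    ((contMDiffAt_const.mul (h.contMDiffAt hx)).mul contMDiffAt_const) hgk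

theorem contDiffAt_left_translate {g : G} {x : V} (hx : x ∈ φ.source)
    (hg : g * φ x ∈ φ.target) :
    ContDiffAt ℝ ∞ (fun y => φ.symm (g * φ y)) x :=
  h.contDiffAt_symm_comp (contMDiffAt_const.mul (h.contMDiffAt hx)) hg

theorem continuousAt_translate {g k : G} {x : V} (hx : x ∈ φ.source) :
    ContinuousAt (fun y => g * φ y * k) x :=
  ((contMDiffAt_const.mul (h.contMDiffAt hx)).mul contMDiffAt_const).continuousAt

theorem contDiffAt_conj :
    ContDiffAt ℝ ∞ (fun p : V × V => φ.symm (φ p.1 * φ p.2 * (φ p.1)⁻¹)) (0, 0) := by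
  have h1 := ContMDiffAt.comp ((0, 0) : V × V) (h.contMDiffAt (x := 0) h.zero_mem)
    contDiff_fst.contMDiff.contMDiffAt
  have h2 := ContMDiffAt.comp ((0, 0) : V × V) (h.contMDiffAt (x := 0) h.zero_mem)
    contDiff_snd.contMDiff.contMDiffAt
  exact h.contDiffAt_symm_comp ((h1.mul h2).mul h1.inv) (by simp [h.map_zero, h.one_mem])

theorem hasFDerivAt_conj (g : G) :
    HasFDerivAt (fun y => φ.symm (g * φ y * g⁻¹)) (adCoord φ g) 0 :=
  ((h.contDiffAt_translate h.zero_mem (by simp [h.map_zero, h.one_mem])).differentiableAt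
    (by simp)).hasFDerivAt

theorem hasFDerivAt_leftCoord {x : V} (hx : x ∈ φ.source) :
    HasFDerivAt (fun y => φ.symm (φ x * φ y)) (leftCoord φ x) 0 :=
  ((h.contDiffAt_left_translate h.zero_mem
    (by simp [h.map_zero, φ.map_source hx])).differentiableAt (by simp)).hasFDerivAt

theorem hasFDerivAt_leftFormCoord {x : V} (hx : x ∈ φ.source) :
    HasFDerivAt (fun y => φ.symm ((φ x)⁻¹ * φ y)) (leftFormCoord φ x) x :=
  ((h.contDiffAt_left_translate hx (by simp [h.one_mem])).differentiableAt (by simp)).hasFDerivAt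

theorem adCoord_one : adCoord φ (1 : G) = ContinuousLinearMap.id ℝ V := by
  refine (h.hasFDerivAt_conj 1).unique ((hasFDerivAt_id 0).congr_of_eventuallyEq ?_)
  filter_upwards [φ.open_source.mem_nhds h.zero_mem] with y hy
  simp [φ.left_inv hy]

theorem adCoord_mul (g k : G) : adCoord φ (g * k) = (adCoord φ g).comp (adCoord φ k) := by
  have hk : φ.symm (k * φ 0 * k⁻¹) = 0 := by simp [h.map_zero, h.symm_one]
  have hg := h.hasFDerivAt_conj g
  rw [← hk] at hg
  refine (h.hasFDerivAt_conj (g * k)).unique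
    ((hg.comp 0 (h.hasFDerivAt_conj k)).congr_of_eventuallyEq ?_)
  have hc := (h.continuousAt_translate (g := k) (k := k⁻¹) h.zero_mem).preimage_mem_nhds
    (φ.open_target.mem_nhds (by simp [h.map_zero, h.one_mem]))
  filter_upwards [hc] with y hy
  simp only [Function.comp_apply]
  rw [φ.right_inv hy]
  simp [mul_assoc]

/-- The Maurer–Cartan form inverts the matrix of the left-invariant fields. -/
theorem leftCoord_comp_leftFormCoord {x : V} (hx : x ∈ φ.source) :
    (leftCoord φ x).comp (leftFormCoord φ x) = ContinuousLinearMap.id ℝ V := by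
  have h0 : φ.symm ((φ x)⁻¹ * φ x) = 0 := by simp [h.symm_one]
  have h1 := h.hasFDerivAt_leftCoord hx
  rw [← h0] at h1
  refine (h1.comp x (h.hasFDerivAt_leftFormCoord hx)).unique
    ((hasFDerivAt_id x).congr_of_eventuallyEq ?_)
  have hc := (h.continuousAt_translate (g := (φ x)⁻¹) (k := 1) hx).preimage_mem_nhds
    (φ.open_target.mem_nhds (by simp [h.one_mem]))
  filter_upwards [hc, φ.open_source.mem_nhds hx] with y hy hy'
  simp only [mem_preimage, mul_one] at hy
  simp only [Function.comp_apply]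
  rw [φ.right_inv hy]
  simp [φ.left_inv hy']

/-- Lie's first fundamental equations: the derivative of the product in the second factor. -/
theorem hasFDerivAt_mul_right {x y : V} (hy : y ∈ φ.source) (hxy : φ x * φ y ∈ φ.target) :
    HasFDerivAt (fun z => φ.symm (φ x * φ z))
      ((leftCoord φ (φ.symm (φ x * φ y))).comp (leftFormCoord φ y)) y := by
  have hs := φ.map_target hxy
  have h0 : φ.symm ((φ y)⁻¹ * φ y) = 0 := by simp [h.symm_one]
  have h1 := h.hasFDerivAt_leftCoord hs
  rw [← h0] at h1
  refine (h1.comp y (h.hasFDerivAt_leftFormCoord hy)).congr_of_eventuallyEq ?_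
  have hc := (h.continuousAt_translate (g := (φ y)⁻¹) (k := 1) hy).preimage_mem_nhds
    (φ.open_target.mem_nhds (by simp [h.one_mem]))
  filter_upwards [hc] with z hz
  simp only [mem_preimage, mul_one] at hz
  simp only [Function.comp_apply]
  rw [φ.right_inv hz, φ.right_inv hxy]
  simp [mul_assoc]

end IsCentredChart

end

/-! ### The differential of the adjoint representation -/

section

variable {E : Type*} [NormedAddCommGroup E] [NormedSpace ℝ E]
  {G : Type*} [TopologicalSpace G] [ChartedSpace E G] [Group G]
  {V : Type*} [NormedAddCommGroup V] [NormedSpace ℝ V]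
namespace IsCentredChart

variable {φ : OpenPartialHomeomorph V G} (h : IsCentredChart (E := E) φ) [LieGroup 𝓘(ℝ, E) ∞ G]
include h

/-- Near the identity the adjoint representation is a partial derivative of a smooth map. -/
theorem contDiffAt_adCoord : ContDiffAt ℝ 1 (fun x => adCoord φ (φ x)) 0 := by
  set c : V × V → V := fun p => φ.symm (φ p.1 * φ p.2 * (φ p.1)⁻¹) with hc
  have hc' : ContDiffAt ℝ ∞ c (0, 0) := h.contDiffAt_conj
  have hd : ContDiffAt ℝ 1 (fderiv ℝ c) (0, 0) :=
    hc'.fderiv_right (m := 1) (by rw [one_add_one_eq_two]; exact ENat.LEInfty.out)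
  have hevc : ∀ᶠ p in 𝓝 ((0, 0) : V × V), DifferentiableAt ℝ c p :=
    ((hc'.of_le (m := 1) ENat.LEInfty.out).eventually (by simp)).mono fun p hp =>
      hp.differentiableAt (by simp)
  have t1 : Tendsto (fun x : V => (x, (0 : V))) (𝓝 0) (𝓝 (0, 0)) :=
    (Continuous.prodMk_left (0 : V)).tendsto' _ _ rfl
  have had : (fun x => adCoord φ (φ x)) =ᶠ[𝓝 0]
      fun x => (fderiv ℝ c (x, 0)).comp (ContinuousLinearMap.inr ℝ V V) := by
    filter_upwards [t1.eventually hevc] with x hx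
    exact (hx.hasFDerivAt.comp (0 : V) (hasFDerivAt_prodMk_right x 0)).fderiv
  refine ContDiffAt.congr_of_eventuallyEq ?_ had
  exact (ContDiffAt.comp (f := fun x : V => (x, (0 : V))) 0 hd
    (contDiffAt_id.prodMk contDiffAt_const)).clm_comp contDiffAt_const

/-- The differential of the adjoint representation at the identity is the bracket of the
left-invariant fields. This is obtained by differentiating `(x y x⁻¹) x = x y` in `y` and then in
`x`; the difference of the two mixed second derivatives of the multiplication remains. -/
theorem hasFDerivAt_adCoord :
    DifferentiableAt ℝ (fun x => adCoord φ (φ x)) 0 ∧ ∀ X Y : V,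
      DifferentiableAt ℝ (fun x => leftCoord φ x X) 0 ∧
      fderiv ℝ (fun x => adCoord φ (φ x)) 0 X Y =
        VectorField.lieBracket ℝ (fun x => leftCoord φ x X) (fun x => leftCoord φ x Y) 0 := by
  set f : V × V → V := fun p => φ.symm (φ p.1 * φ p.2) with hf
  have hf' : ContDiffAt ℝ ∞ f (0, 0) :=
    h.contDiffAt_mul h.zero_mem h.zero_mem (by simp [h.map_zero, h.one_mem])
  have hd2 : DifferentiableAt ℝ (fderiv ℝ f) (0, 0) :=
    (hf'.fderiv_right (m := 1)
      (by rw [one_add_one_eq_two]; exact ENat.LEInfty.out)).differentiableAt (by simp)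
  set S := fderiv ℝ (fderiv ℝ f) (0, 0) with hS
  have hsymm : ∀ p q, S p q = S q p := fun p q =>
    (hf'.isSymmSndFDerivAt (by simpa using ENat.LEInfty.out)) p q
  have hev : ∀ᶠ p in 𝓝 ((0, 0) : V × V), DifferentiableAt ℝ f p :=
    ((hf'.of_le (m := 1) ENat.LEInfty.out).eventually (by simp)).mono fun p hp =>
      hp.differentiableAt (by simp)
  have t1 : Tendsto (fun x : V => (x, (0 : V))) (𝓝 0) (𝓝 (0, 0)) :=
    (Continuous.prodMk_left (0 : V)).tendsto' _ _ rfl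
  have t2 : Tendsto (fun x : V => ((0 : V), x)) (𝓝 0) (𝓝 (0, 0)) :=
    (Continuous.prodMk_right (0 : V)).tendsto' _ _ rfl
  have i1 : HasFDerivAt (fun x : V => (x, (0 : V))) (ContinuousLinearMap.inl ℝ V V) 0 :=
    hasFDerivAt_prodMk_left 0 0
  have i2 : HasFDerivAt (fun x : V => ((0 : V), x)) (ContinuousLinearMap.inr ℝ V V) 0 :=
    hasFDerivAt_prodMk_right 0 0
  -- the components of the left-invariant fields are partial derivatives of the multiplication
  have hleft : (fun x => leftCoord φ x) =ᶠ[𝓝 0]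
      fun x => (fderiv ℝ f (x, 0)).comp (ContinuousLinearMap.inr ℝ V V) := by
    filter_upwards [t1.eventually hev] with x hx
    exact (hx.hasFDerivAt.comp (0 : V) (hasFDerivAt_prodMk_right x 0)).fderiv
  have hleftd : HasFDerivAt (fun x => (fderiv ℝ f (x, 0)).comp (ContinuousLinearMap.inr ℝ V V))
      (((ContinuousLinearMap.compL ℝ V (V × V) V).flip (ContinuousLinearMap.inr ℝ V V)).comp
        (S.comp (ContinuousLinearMap.inl ℝ V V))) 0 :=
    ((ContinuousLinearMap.compL ℝ V (V × V) V).flip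
      (ContinuousLinearMap.inr ℝ V V)).hasFDerivAt.comp (0 : V)
        (HasFDerivAt.comp (0 : V) hd2.hasFDerivAt i1)
  have hLd := hleftd.congr_of_eventuallyEq hleft
  have hadd := h.contDiffAt_adCoord.differentiableAt one_ne_zero
  have hLX : ∀ X, HasFDerivAt (fun x => leftCoord φ x X)
      ((ContinuousLinearMap.apply ℝ V X).comp
      (((ContinuousLinearMap.compL ℝ V (V × V) V).flip (ContinuousLinearMap.inr ℝ V V)).comp
        (S.comp (ContinuousLinearMap.inl ℝ V V)))) 0 := fun X =>
    (ContinuousLinearMap.apply ℝ V X).hasFDerivAt.comp (0 : V) hLd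
  refine ⟨hadd, fun X Y => ⟨(hLX X).differentiableAt, ?_⟩⟩
  have hL0 : leftCoord φ 0 = ContinuousLinearMap.id ℝ V := by
    refine (h.hasFDerivAt_leftCoord h.zero_mem).unique
      ((hasFDerivAt_id 0).congr_of_eventuallyEq ?_)
    filter_upwards [φ.open_source.mem_nhds h.zero_mem] with y hy
    simp [h.map_zero, φ.left_inv hy]
  have hA0 : adCoord φ (φ 0) = ContinuousLinearMap.id ℝ V := by
    rw [h.map_zero, h.adCoord_one]
  have hf1 : (fderiv ℝ f (0, 0)).comp (ContinuousLinearMap.inl ℝ V V) =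
      ContinuousLinearMap.id ℝ V := by
    refine HasFDerivAt.unique
      (HasFDerivAt.comp (f := fun x : V => (x, (0 : V))) 0 (hev.self_of_nhds).hasFDerivAt i1)
      ((hasFDerivAt_id 0).congr_of_eventuallyEq ?_)
    filter_upwards [φ.open_source.mem_nhds h.zero_mem] with y hy
    simp [hf, h.map_zero, φ.left_inv hy]
  -- the identity `(x y x⁻¹) x = x y`, differentiated in `y` at the identity
  have key : ∀ᶠ x in 𝓝 (0 : V), fderiv ℝ f (0, x) (adCoord φ (φ x) Y, 0) = leftCoord φ x Y := by
    filter_upwards [t2.eventually hev, φ.open_source.mem_nhds h.zero_mem]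
      with x hx hxs
    have e0 : φ.symm (φ x * φ 0 * (φ x)⁻¹) = 0 := by simp [h.map_zero, h.symm_one]
    have h1 : HasFDerivAt f (fderiv ℝ f (0, x)) (φ.symm (φ x * φ 0 * (φ x)⁻¹), x) := by
      rw [e0]; exact hx.hasFDerivAt
    have h2 := HasFDerivAt.comp (0 : V) h1
      ((h.hasFDerivAt_conj (φ x)).prodMk (hasFDerivAt_const x (0 : V)))
    have h3 := h2.unique (f := f ∘ fun y => (φ.symm (φ x * φ y * (φ x)⁻¹), x))
      ((h.hasFDerivAt_leftCoord hxs).congr_of_eventuallyEq (by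
        have hcn := (h.continuousAt_translate (g := φ x) (k := (φ x)⁻¹)
          h.zero_mem).preimage_mem_nhds
          (φ.open_target.mem_nhds (by simp [h.map_zero, h.one_mem]))
        filter_upwards [hcn] with y hy
        simp only [hf, Function.comp_apply]
        rw [φ.right_inv hy]
        simp))
    simpa using congrArg (fun T : V →L[ℝ] V => T Y) h3
  have hAY : HasFDerivAt (fun x => ((adCoord φ (φ x) Y, 0) : V × V))
      ((ContinuousLinearMap.inl ℝ V V).comp ((ContinuousLinearMap.apply ℝ V Y).comp
        (fderiv ℝ (fun x => adCoord φ (φ x)) 0))) 0 :=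
    (ContinuousLinearMap.inl ℝ V V).hasFDerivAt.comp (0 : V)
      ((ContinuousLinearMap.apply ℝ V Y).hasFDerivAt.comp (0 : V) hadd.hasFDerivAt)
  have hprod := (HasFDerivAt.comp (0 : V) hd2.hasFDerivAt i2).clm_apply hAY
  have heq := congrArg (fun T : V →L[ℝ] V => T X)
    (hprod.unique ((hLX Y).congr_of_eventuallyEq key))
  simp only [Function.comp_apply, add_apply, ContinuousLinearMap.comp_apply,
    ContinuousLinearMap.flip_apply, ContinuousLinearMap.inl_apply, ContinuousLinearMap.inr_apply,
    ContinuousLinearMap.apply_apply, ContinuousLinearMap.compL_apply, hA0,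
    ContinuousLinearMap.id_apply] at heq
  have hf1' : ∀ Z, fderiv ℝ f (0, 0) (Z, 0) = Z := fun Z => by
    simpa using congrArg (fun T : V →L[ℝ] V => T Z) hf1
  rw [hf1', ← hS, hsymm (0, X)] at heq
  rw [VectorField.lieBracket, (hLX X).fderiv, (hLX Y).fderiv, hL0]
  simp only [ContinuousLinearMap.comp_apply,
    ContinuousLinearMap.flip_apply, ContinuousLinearMap.inl_apply, ContinuousLinearMap.inr_apply,
    ContinuousLinearMap.apply_apply, ContinuousLinearMap.compL_apply, ContinuousLinearMap.id_apply]
  rw [← heq]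
  abel
end IsCentredChart

end

/-! ### Left-invariant fields in coordinates -/

section

variable {E : Type*} [NormedAddCommGroup E] [NormedSpace ℝ E]
  {G : Type*} [TopologicalSpace G] [ChartedSpace E G] [Group G]
  {V : Type*} [NormedAddCommGroup V] [NormedSpace ℝ V]

/-- The coordinates of an element of the Lie algebra: the derivative of the coordinate system at
the identity. -/
def toCoord (φ : OpenPartialHomeomorph V G) : GroupLieAlgebra 𝓘(ℝ, E) G →L[ℝ] V :=
  mfderiv 𝓘(ℝ, E) 𝓘(ℝ, V) φ.symm (1 : G)

/-- The element of the Lie algebra with given coordinates. -/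
def ofCoord (φ : OpenPartialHomeomorph V G) : V →L[ℝ] GroupLieAlgebra 𝓘(ℝ, E) G :=
  mfderiv 𝓘(ℝ, V) 𝓘(ℝ, E) φ (0 : V)

/-- Left-invariance: a differential applied to a left-invariant field is the derivative at the
identity of the translated map. -/
theorem mfderiv_mulInvariantVectorField {M : Type*} [TopologicalSpace M] [ChartedSpace V M]
    [LieGroup 𝓘(ℝ, E) ∞ G] {F : G → M} {g : G} {F' : E →L[ℝ] V}
    (hF : HasMFDerivAt 𝓘(ℝ, E) 𝓘(ℝ, V) F g F') (X : GroupLieAlgebra 𝓘(ℝ, E) G) :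
    F' (mulInvariantVectorField X g : E) =
      (mfderiv 𝓘(ℝ, E) 𝓘(ℝ, V) (fun k => F (g * k)) (1 : G) : E →L[ℝ] V) X := by
  have h1 : ∀ g', g' = g → HasMFDerivAt 𝓘(ℝ, E) 𝓘(ℝ, V) F g' F' := by
    rintro _ rfl; exact hF
  have h2 : HasMFDerivAt 𝓘(ℝ, E) 𝓘(ℝ, E) (fun k => g * k) (1 : G)
      (mfderiv 𝓘(ℝ, E) 𝓘(ℝ, E) (fun k => g * k) (1 : G)) :=
    ((contMDiff_mul_left (I := 𝓘(ℝ, E)) (n := ∞) (a := g)).contMDiffAt.mdifferentiableAt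
      (by simp)).hasMFDerivAt
  exact ((h1 _ (mul_one g)).comp (1 : G) h2).mfderiv.symm ▸ rfl

namespace IsCentredChart

variable {φ : OpenPartialHomeomorph V G} (h : IsCentredChart (E := E) φ)
include h

theorem mdifferentiable : φ.MDifferentiable 𝓘(ℝ, V) 𝓘(ℝ, E) :=
  ⟨h.smooth.mdifferentiableOn (by simp), h.smooth_symm.mdifferentiableOn (by simp)⟩

theorem hasMFDerivAt_ofCoord : HasMFDerivAt 𝓘(ℝ, V) 𝓘(ℝ, E) φ 0 (ofCoord (E := E) (V := V) φ) :=
  ((h.contMDiffAt h.zero_mem).mdifferentiableAt (by simp)).hasMFDerivAt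

theorem hasMFDerivAt_toCoord :
    HasMFDerivAt 𝓘(ℝ, E) 𝓘(ℝ, V) φ.symm (1 : G) (toCoord (E := E) (V := V) φ) :=
  ((h.contMDiffAt_symm h.one_mem).mdifferentiableAt (by simp)).hasMFDerivAt

theorem toCoord_ofCoord (v : V) : toCoord (E := E) φ (ofCoord φ v) = v := by
  have h1 : HasMFDerivAt 𝓘(ℝ, E) 𝓘(ℝ, V) φ.symm (φ 0) (toCoord (E := E) (V := V) φ) := by
    rw [h.map_zero]; exact h.hasMFDerivAt_toCoord
  have h2 := (h1.comp (0 : V) h.hasMFDerivAt_ofCoord).hasFDerivAt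
  have h3 : (toCoord (E := E) (V := V) φ).comp (ofCoord φ) = ContinuousLinearMap.id ℝ V :=
    HasFDerivAt.unique (E := V) (F := V) h2 ((hasFDerivAt_id (𝕜 := ℝ)
      (0 : V)).congr_of_eventuallyEq (by
      filter_upwards [φ.open_source.mem_nhds h.zero_mem] with y hy
      simp [φ.left_inv hy]))
  exact congrArg (fun T : V →L[ℝ] V => T v) h3

theorem ofCoord_toCoord (X : GroupLieAlgebra 𝓘(ℝ, E) G) : ofCoord φ (toCoord φ X) = X := by
  have h1 : HasMFDerivAt 𝓘(ℝ, V) 𝓘(ℝ, E) φ (φ.symm (1 : G)) (ofCoord (E := E) (V := V) φ) := by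
    rw [h.symm_one]; exact h.hasMFDerivAt_ofCoord
  have h2 := h1.comp (1 : G) h.hasMFDerivAt_toCoord
  have h3 := hasMFDerivAt_unique h2 ((hasMFDerivAt_id (I := 𝓘(ℝ, E))
    (1 : G)).congr_of_eventuallyEq (by
    filter_upwards [φ.open_target.mem_nhds h.one_mem] with y hy
    simp [φ.right_inv hy]))
  exact congrArg (fun T : E →L[ℝ] E => T X) h3

variable [LieGroup 𝓘(ℝ, E) ∞ G]

/-- In the coordinates `φ`, the left-invariant field generated by `X` has the components
`leftCoord φ x (toCoord φ X)`. -/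
theorem mpullback_mulInvariantVectorField {x : V} (hx : x ∈ φ.source)
    (X : GroupLieAlgebra 𝓘(ℝ, E) G) :
    (VectorField.mpullback 𝓘(ℝ, V) 𝓘(ℝ, E) φ (mulInvariantVectorField X) x : V) =
      leftCoord φ x (toCoord φ X) := by
  have hd := h.mdifferentiable
  have hi : (mfderiv 𝓘(ℝ, V) 𝓘(ℝ, E) φ x).inverse = (mfderiv 𝓘(ℝ, E) 𝓘(ℝ, V) φ.symm (φ x) :) :=
    ContinuousLinearMap.inverse_equiv (hd.mfderiv hx)
  have h1 : HasMFDerivAt 𝓘(ℝ, E) 𝓘(ℝ, V) φ.symm (φ x) (mfderiv 𝓘(ℝ, E) 𝓘(ℝ, V) φ.symm (φ x)) :=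
    ((h.contMDiffAt_symm (φ.map_source hx)).mdifferentiableAt (by simp)).hasMFDerivAt
  rw [VectorField.mpullback_apply, hi]
  refine (mfderiv_mulInvariantVectorField h1 X).trans ?_
  have h2 : HasMFDerivAt 𝓘(ℝ, E) 𝓘(ℝ, V) (fun k => φ.symm (φ x * k)) (φ 0)
      (mfderiv 𝓘(ℝ, E) 𝓘(ℝ, V) (fun k => φ.symm (φ x * k)) (1 : G) : E →L[ℝ] V) := by
    rw [h.map_zero]
    refine MDifferentiableAt.hasMFDerivAt ?_
    refine (ContMDiffAt.comp (1 : G) (h.contMDiffAt_symm (g := φ x * 1) ?_)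
      (contMDiffAt_const.mul contMDiffAt_id)).mdifferentiableAt (by simp)
    simpa using φ.map_source hx
  have h3 := (h2.comp (0 : V) h.hasMFDerivAt_ofCoord).hasFDerivAt
  have h4 : _ = leftCoord φ x :=
    HasFDerivAt.unique (E := V) (F := V) h3 (h.hasFDerivAt_leftCoord hx)
  rw [← h4]
  exact congrArg (mfderiv 𝓘(ℝ, E) 𝓘(ℝ, V) (fun k => φ.symm (φ x * k)) (1 : G) : E →L[ℝ] V)
    (h.ofCoord_toCoord X).symm

theorem lieBracket_leftCoord [CompleteSpace E] [CompleteSpace V] (X Y : GroupLieAlgebra 𝓘(ℝ, E) G) :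
    toCoord φ ⁅X, Y⁆ = VectorField.lieBracket ℝ (fun x => leftCoord φ x (toCoord φ X))
      (fun x => leftCoord φ x (toCoord φ Y)) 0 := by
  have h1 := VectorField.mpullback_mlieBracket (I := 𝓘(ℝ, V)) (I' := 𝓘(ℝ, E)) (f := φ)
    (x₀ := (0 : V)) (V := mulInvariantVectorField X) (W := mulInvariantVectorField Y) (n := ∞)
    (mdifferentiableAt_mulInvariantVectorField X)
    (mdifferentiableAt_mulInvariantVectorField Y) (h.contMDiffAt h.zero_mem)
    (by rw [minSmoothness_of_isRCLikeNormedField]; exact ENat.LEInfty.out)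
  rw [← VectorField.mlieBracketWithin_univ (I := 𝓘(ℝ, V)),
    VectorField.mlieBracketWithin_eq_lieBracketWithin] at h1
  have h2 : ∀ Z : GroupLieAlgebra 𝓘(ℝ, E) G,
      (VectorField.mpullback 𝓘(ℝ, V) 𝓘(ℝ, E) φ (mulInvariantVectorField Z) : V → V) =ᶠ[𝓝 0]
        fun x => leftCoord φ x (toCoord φ Z) := fun Z => by
    filter_upwards [φ.open_source.mem_nhds h.zero_mem] with x hx
    exact h.mpullback_mulInvariantVectorField hx Z
  refine Eq.trans ?_ (h1.trans <|
    (congrFun (VectorField.lieBracketWithin_univ (𝕜 := ℝ) (E := V)) (0 : V)).trans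
      (Filter.EventuallyEq.lieBracket_vectorField_eq
      (E := V) (x := (0 : V)) (h2 X) (h2 Y)))
  have hi : (mfderiv 𝓘(ℝ, V) 𝓘(ℝ, E) φ 0).inverse =
      (mfderiv 𝓘(ℝ, E) 𝓘(ℝ, V) φ.symm (φ 0) :) :=
    ContinuousLinearMap.inverse_equiv (h.mdifferentiable.mfderiv h.zero_mem)
  rw [VectorField.mpullback_apply, hi]
  have h5 : ∀ g : G, g = 1 → (mfderiv 𝓘(ℝ, E) 𝓘(ℝ, V) φ.symm (1 : G) : E →L[ℝ] V)
      (VectorField.mlieBracket 𝓘(ℝ, E) (mulInvariantVectorField X) (mulInvariantVectorField Y)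
        (1 : G)) = (mfderiv 𝓘(ℝ, E) 𝓘(ℝ, V) φ.symm g : E →L[ℝ] V)
      (VectorField.mlieBracket 𝓘(ℝ, E) (mulInvariantVectorField X) (mulInvariantVectorField Y)
        g) := by
    rintro _ rfl; rfl
  exact h5 _ h.map_zero

/-- In the coordinates `φ`, the bracket is the differential of the adjoint representation. -/
theorem toCoord_lie [CompleteSpace E] [CompleteSpace V] (X Y : GroupLieAlgebra 𝓘(ℝ, E) G) :
    toCoord φ ⁅X, Y⁆ = fderiv ℝ (fun x => adCoord φ (φ x)) 0 (toCoord φ X) (toCoord φ Y) := by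
  rw [h.lieBracket_leftCoord, (h.hasFDerivAt_adCoord.2 _ _).2]

end IsCentredChart

/-- A curve is an integral curve of the left-invariant field generated by `X` if and only if its
left logarithmic derivative is constantly `X`. -/
theorem IsCentredChart.isMIntegralCurve_iff {φ : OpenPartialHomeomorph V G}
    (h : IsCentredChart (E := E) φ) [LieGroup 𝓘(ℝ, E) ∞ G] {γ : ℝ → G}
    {X : GroupLieAlgebra 𝓘(ℝ, E) G} :
    IsMIntegralCurve (I := 𝓘(ℝ, E)) γ (fun g => mulInvariantVectorField X g) ↔
      Continuous γ ∧ ∀ t, HasDerivAt (fun t' => φ.symm ((γ t)⁻¹ * γ t')) (toCoord φ X) t := by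
  refine ⟨fun hγ => ⟨hγ.continuous, fun t => ?_⟩, fun ⟨hc, hγ⟩ t => ?_⟩
  · have h1 : HasMFDerivAt 𝓘(ℝ, E) 𝓘(ℝ, V) (fun k => φ.symm ((γ t)⁻¹ * k)) (γ t)
        (mfderiv 𝓘(ℝ, E) 𝓘(ℝ, V) (fun k => φ.symm ((γ t)⁻¹ * k)) (γ t)) := by
      refine MDifferentiableAt.hasMFDerivAt ?_
      refine (ContMDiffAt.comp (γ t) (h.contMDiffAt_symm (g := (γ t)⁻¹ * γ t) ?_)
        (contMDiffAt_const.mul contMDiffAt_id)).mdifferentiableAt (by simp)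
      simp [h.one_mem]
    have h2 := (h1.comp t (hγ t)).hasFDerivAt
    rw [hasDerivAt_iff_hasFDerivAt]
    refine HasFDerivAt.congr_fderiv (E := ℝ) (F := V) h2 ?_
    ext
    have hf : (fun k => φ.symm ((γ t)⁻¹ * (γ t * k))) = φ.symm := by
      ext k
      rw [inv_mul_cancel_left]
    have h3 := (mfderiv_mulInvariantVectorField h1 X).trans
      (congrArg (fun F => (mfderiv 𝓘(ℝ, E) 𝓘(ℝ, V) F (1 : G) : E →L[ℝ] V) X) hf)
    refine Eq.trans ?_ ((congrArg (fun v : V => (1 : ℝ) • v) h3).trans (?_ : _ = _))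
    · exact map_smul (mfderiv 𝓘(ℝ, E) 𝓘(ℝ, V) (fun k => φ.symm ((γ t)⁻¹ * k)) (γ t) : E →L[ℝ] V)
        (1 : ℝ) (mulInvariantVectorField X (γ t) : E)
    · exact (one_smul ℝ _).trans (one_smul ℝ (toCoord φ X)).symm
  · have h1 : HasMFDerivAt 𝓘(ℝ, E) 𝓘(ℝ, E) (fun k => γ t * k) (φ 0)
        (mfderiv 𝓘(ℝ, E) 𝓘(ℝ, E) (fun k => γ t * k) (1 : G) : E →L[ℝ] E) := by
      rw [h.map_zero]
      exact (contMDiff_mul_left.contMDiffAt.mdifferentiableAt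
        (n := ∞) (by simp)).hasMFDerivAt
    have h2 : HasMFDerivAt 𝓘(ℝ, V) 𝓘(ℝ, E) (fun v => γ t * φ v) (φ.symm ((γ t)⁻¹ * γ t))
        ((mfderiv 𝓘(ℝ, E) 𝓘(ℝ, E) (fun k => γ t * k) (1 : G) : E →L[ℝ] E).comp
          (ofCoord (E := E) (V := V) φ)) := by
      rw [inv_mul_cancel, h.symm_one]
      exact h1.comp (0 : V) h.hasMFDerivAt_ofCoord
    have h3 := h2.comp t (hγ t).hasFDerivAt.hasMFDerivAt
    have h4 := h3.congr_of_eventuallyEq (f₁ := γ) (by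
      have := topologicalGroup_of_lieGroup (G := G) 𝓘(ℝ, E) ∞
      have := (continuous_const.mul hc).continuousAt.preimage_mem_nhds (x := t)
        (φ.open_target.mem_nhds (show (γ t)⁻¹ * γ t ∈ φ.target by simp [h.one_mem]))
      filter_upwards [this] with t' ht'
      simp only [Function.comp_apply]
      rw [φ.right_inv (show (γ t)⁻¹ * γ t' ∈ φ.target from ht')]
      simp)
    refine HasMFDerivAt.congr_mfderiv h4 ?_
    ext
    have h5 := congrArg (mfderiv 𝓘(ℝ, E) 𝓘(ℝ, E) (fun k => γ t * k) (1 : G) : E →L[ℝ] E)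
      (h.ofCoord_toCoord X)
    have h6 := congrArg (fun w : V => (mfderiv 𝓘(ℝ, E) 𝓘(ℝ, E) (fun k => γ t * k) (1 : G) :
      E →L[ℝ] E) (ofCoord φ w)) (one_smul ℝ (toCoord φ X))
    exact (h6.trans h5).trans (one_smul ℝ (mulInvariantVectorField X (γ t) : E)).symm

end

/-! ### One-parameter subgroups -/

section

variable {E : Type*} [NormedAddCommGroup E] [NormedSpace ℝ E]
  {G : Type*} [TopologicalSpace G] [ChartedSpace E G] [Group G] [LieGroup 𝓘(ℝ, E) ∞ G]
  {V : Type*} [NormedAddCommGroup V] [NormedSpace ℝ V]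

theorem contMDiff_one_mulInvariantVectorField (X : GroupLieAlgebra 𝓘(ℝ, E) G) :
    ContMDiff 𝓘(ℝ, E) 𝓘(ℝ, E).tangent 1
      (fun g : G => (mulInvariantVectorField X g : TangentBundle 𝓘(ℝ, E) G)) :=
  (contMDiff_mulInvariantVectorField X).of_le
    (by rw [minSmoothness_of_isRCLikeNormedField]; norm_num)

/-- Left translations map integral curves of left-invariant fields to such curves. -/
theorem isMIntegralCurveOn_mul_left {γ : ℝ → G} {X : GroupLieAlgebra 𝓘(ℝ, E) G} {S : Set ℝ}
    (hγ : IsMIntegralCurveOn (I := 𝓘(ℝ, E)) γ (fun g => mulInvariantVectorField X g) S) (a : G) :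
    IsMIntegralCurveOn (I := 𝓘(ℝ, E)) (fun t => a * γ t)
      (fun g => mulInvariantVectorField X g) S := by
  intro t ht
  have h1 : HasMFDerivAt 𝓘(ℝ, E) 𝓘(ℝ, E) (fun k => a * k) (γ t)
      (mfderiv 𝓘(ℝ, E) 𝓘(ℝ, E) (fun k => a * k) (γ t)) :=
    ((contMDiff_mul_left (I := 𝓘(ℝ, E)) (n := ∞) (a := a)).contMDiffAt.mdifferentiableAt
      (by simp)).hasMFDerivAt
  have hf : (fun k => a * (γ t * k)) = fun k => (a * γ t) * k := by
    ext k
    rw [mul_assoc]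
  have h3 := (mfderiv_mulInvariantVectorField h1 X).trans
      (congrArg (fun F => (mfderiv 𝓘(ℝ, E) 𝓘(ℝ, E) F (1 : G) : E →L[ℝ] E) X) hf)
  refine HasMFDerivWithinAt.congr_mfderiv (h1.comp_hasMFDerivWithinAt t (hγ t ht)) ?_
  ext
  refine Eq.trans ?_ (congrArg (fun v : E => (1 : ℝ) • v) h3)
  exact map_smul (mfderiv 𝓘(ℝ, E) 𝓘(ℝ, E) (fun k => a * k) (γ t) : E →L[ℝ] E)
    (1 : ℝ) (mulInvariantVectorField X (γ t) : E)

theorem isMIntegralCurve_mul_left {γ : ℝ → G} {X : GroupLieAlgebra 𝓘(ℝ, E) G}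
    (hγ : IsMIntegralCurve (I := 𝓘(ℝ, E)) γ (fun g => mulInvariantVectorField X g)) (a : G) :
    IsMIntegralCurve (I := 𝓘(ℝ, E)) (fun t => a * γ t)
      (fun g => mulInvariantVectorField X g) :=
  isMIntegralCurve_iff_isMIntegralCurveOn.2
    (isMIntegralCurveOn_mul_left (hγ.isMIntegralCurveOn univ) a)

variable [T2Space G]

theorem isMIntegralCurve_unique {γ γ' : ℝ → G} {X : GroupLieAlgebra 𝓘(ℝ, E) G}
    (hγ : IsMIntegralCurve (I := 𝓘(ℝ, E)) γ (fun g => mulInvariantVectorField X g))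
    (hγ' : IsMIntegralCurve (I := 𝓘(ℝ, E)) γ' (fun g => mulInvariantVectorField X g))
    (h : γ 0 = γ' 0) : γ = γ' := by
  have : IsManifold 𝓘(ℝ, E) 1 G := IsManifold.of_le (n := ∞) ENat.LEInfty.out
  exact isMIntegralCurve_Ioo_eq_of_contMDiff_boundaryless
    (contMDiff_one_mulInvariantVectorField X) hγ hγ' h

variable [CompleteSpace E]

/-- Left-invariant fields are complete: left translations extend a local integral curve through
the identity to all starting points with the same time of existence. -/
theorem exists_isMIntegralCurve_mulInvariantVectorField (X : GroupLieAlgebra 𝓘(ℝ, E) G) :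
    ∃ γ : ℝ → G, γ 0 = 1 ∧
      IsMIntegralCurve (I := 𝓘(ℝ, E)) γ (fun g => mulInvariantVectorField X g) := by
  have : IsManifold 𝓘(ℝ, E) 1 G := IsManifold.of_le (n := ∞) ENat.LEInfty.out
  obtain ⟨γ, h0, hγ⟩ := exists_isMIntegralCurveAt_of_contMDiffAt_boundaryless (I := 𝓘(ℝ, E)) 0
    (contMDiff_one_mulInvariantVectorField X).contMDiffAt (x₀ := (1 : G))
  obtain ⟨ε, hε, hγ⟩ := isMIntegralCurveAt_iff'.1 hγ
  refine exists_isMIntegralCurve_of_isMIntegralCurveOn (contMDiff_one_mulInvariantVectorField X) hε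
    (fun x => ⟨fun t => x * γ t, by simp [h0], ?_⟩) 1
  rw [Real.ball_eq_Ioo, zero_sub, zero_add] at hγ
  exact isMIntegralCurveOn_mul_left hγ x

/-- The integral curve through the identity of the left-invariant field generated by `X` is
`t ↦ exp(tX)`. -/
theorem eq_lieExp {γ : ℝ → G} {X : GroupLieAlgebra 𝓘(ℝ, E) G}
    (hγ : IsMIntegralCurve (I := 𝓘(ℝ, E)) γ (fun g => mulInvariantVectorField X g))
    (h : γ 0 = 1) (t : ℝ) : γ t = lieExp (t • X) := by
  have hs := Classical.epsilon_spec (exists_isMIntegralCurve_mulInvariantVectorField (t • X))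
  have h1 := hγ.comp_mul t
  have h2 : IsMIntegralCurve (I := 𝓘(ℝ, E)) (γ ∘ (· * t))
      (fun g => mulInvariantVectorField (t • X) g) := by
    rw [mulInvariantVectorField_smul]
    exact h1
  have h3 := isMIntegralCurve_unique h2 hs.2 (by simp [h, hs.1])
  have h4 := congrFun h3 1
  simp only [Function.comp_apply, one_mul] at h4
  exact h4

theorem isMIntegralCurve_lieExp (X : GroupLieAlgebra 𝓘(ℝ, E) G) :
    IsMIntegralCurve (I := 𝓘(ℝ, E)) (fun t : ℝ => lieExp (t • X))
      (fun g => mulInvariantVectorField X g) := by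
  obtain ⟨γ, h0, hγ⟩ := exists_isMIntegralCurve_mulInvariantVectorField X
  rwa [← funext (eq_lieExp hγ h0)]

theorem lieExp_zero : lieExp (0 : GroupLieAlgebra 𝓘(ℝ, E) G) = 1 := by
  obtain ⟨γ, h0, hγ⟩ := exists_isMIntegralCurve_mulInvariantVectorField
    (0 : GroupLieAlgebra 𝓘(ℝ, E) G)
  have h1 := eq_lieExp hγ h0 0
  rw [zero_smul, h0] at h1
  exact h1.symm

theorem lieExp_add_smul (a b : ℝ) (X : GroupLieAlgebra 𝓘(ℝ, E) G) :
    lieExp ((a + b) • X) = lieExp (a • X) * lieExp (b • X) := by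
  have h1 := isMIntegralCurve_mul_left ((isMIntegralCurve_lieExp X).comp_add a)
    (lieExp (a • X))⁻¹
  have h2 := eq_lieExp h1 (by simp) b
  rw [← h2]
  simp [add_comm]

theorem lieExp_neg (X : GroupLieAlgebra 𝓘(ℝ, E) G) : lieExp (-X) = (lieExp X)⁻¹ := by
  have h1 := lieExp_add_smul (-1) 1 X
  rw [neg_add_cancel, zero_smul, lieExp_zero, neg_one_smul, one_smul] at h1
  exact eq_inv_of_mul_eq_one_left h1.symm

namespace IsCentredChart

variable {φ : OpenPartialHomeomorph V G} (h : IsCentredChart (E := E) φ)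
include h

theorem hasDerivAt_symm_lieExp (X : GroupLieAlgebra 𝓘(ℝ, E) G) :
    HasDerivAt (fun t : ℝ => φ.symm (lieExp (t • X))) (toCoord φ X) 0 := by
  have h1 := (h.isMIntegralCurve_iff.1 (isMIntegralCurve_lieExp X)).2 0
  simpa [lieExp_zero] using h1

theorem continuous_lieExp (X : GroupLieAlgebra 𝓘(ℝ, E) G) :
    Continuous (fun t : ℝ => lieExp (t • X)) :=
  (h.isMIntegralCurve_iff.1 (isMIntegralCurve_lieExp X)).1

theorem hasDerivAt_conj_lieExp (g : G) (X : GroupLieAlgebra 𝓘(ℝ, E) G) :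
    HasDerivAt (fun t : ℝ => φ.symm (g * lieExp (t • X) * g⁻¹)) (adCoord φ g (toCoord φ X)) 0 := by
  have h1 : HasFDerivAt (fun y => φ.symm (g * φ y * g⁻¹)) (adCoord φ g)
      (φ.symm (lieExp ((0 : ℝ) • X))) := by
    rw [zero_smul, lieExp_zero, h.symm_one]
    exact h.hasFDerivAt_conj g
  refine (h1.comp_hasDerivAt (0 : ℝ) (h.hasDerivAt_symm_lieExp X)).congr_of_eventuallyEq ?_
  have := (h.continuous_lieExp X).continuousAt.preimage_mem_nhds (x := 0)
    (φ.open_target.mem_nhds (by simp [lieExp_zero, h.one_mem]))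
  filter_upwards [this] with t ht
  simp only [Function.comp_apply]
  rw [φ.right_inv ht]

/-- Conjugation by `g` maps the one-parameter subgroup of `X` to the one of `Ad(g) X`. -/
theorem conj_lieExp {g : G} {X Y : GroupLieAlgebra 𝓘(ℝ, E) G}
    (hXY : adCoord φ g (toCoord φ X) = toCoord φ Y) (t : ℝ) :
    g * lieExp (t • X) * g⁻¹ = lieExp (t • Y) := by
  have := topologicalGroup_of_lieGroup (G := G) 𝓘(ℝ, E) ∞
  refine eq_lieExp (γ := fun t => g * lieExp (t • X) * g⁻¹) (h.isMIntegralCurve_iff.2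
    ⟨(continuous_const.mul (h.continuous_lieExp X)).mul continuous_const, fun t => ?_⟩)
    (by simp [lieExp_zero]) t
  have h1 := h.hasDerivAt_conj_lieExp g X
  rw [hXY, ← sub_self t] at h1
  refine (h1.comp_sub_const t t).congr_of_eventuallyEq (Eventually.of_forall fun t' => ?_)
  have h2 : lieExp ((t' - t) • X) = (lieExp (t • X))⁻¹ * lieExp (t' • X) := by
    rw [← lieExp_neg, ← neg_smul, ← lieExp_add_smul, sub_eq_neg_add]
  simp only [h2, mul_inv_rev, mul_assoc, inv_inv, inv_mul_cancel_left]

theorem hasDerivAt_adCoord_lieExp (X : GroupLieAlgebra 𝓘(ℝ, E) G) (t : ℝ) :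
    HasDerivAt (fun t : ℝ => adCoord φ (lieExp (t • X)))
      (adCoord φ (lieExp (t • X)) * fderiv ℝ (fun x => adCoord φ (φ x)) 0 (toCoord φ X)) t := by
  have h1 : HasFDerivAt (fun x => adCoord φ (φ x)) (fderiv ℝ (fun x => adCoord φ (φ x)) 0)
      (φ.symm (lieExp ((0 : ℝ) • X))) := by
    rw [zero_smul, lieExp_zero, h.symm_one]
    exact h.hasFDerivAt_adCoord.1.hasFDerivAt
  have h2 : HasDerivAt (fun t : ℝ => adCoord φ (lieExp (t • X)))
      (fderiv ℝ (fun x => adCoord φ (φ x)) 0 (toCoord φ X)) 0 := by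
    refine (h1.comp_hasDerivAt (0 : ℝ) (h.hasDerivAt_symm_lieExp X)).congr_of_eventuallyEq ?_
    have := (h.continuous_lieExp X).continuousAt.preimage_mem_nhds (x := 0)
      (φ.open_target.mem_nhds (by simp [lieExp_zero, h.one_mem]))
    filter_upwards [this] with t ht
    simp only [Function.comp_apply]
    rw [φ.right_inv ht]
  rw [← sub_self t] at h2
  refine ((h2.comp_sub_const t t).const_mul (adCoord φ (lieExp (t • X)))).congr_of_eventuallyEq
    (Eventually.of_forall fun t' => ?_)
  have h3 : lieExp (t' • X) = lieExp (t • X) * lieExp ((t' - t) • X) := by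
    rw [← lieExp_add_smul, add_sub_cancel]
  change adCoord φ (lieExp (t' • X)) = _
  rw [h3, h.adCoord_mul]
  rfl

/-- `Ad(exp(tX)) = exp(t ad X)`, in the coordinates `φ`. -/
theorem adCoord_lieExp [CompleteSpace V] (X : GroupLieAlgebra 𝓘(ℝ, E) G) (t : ℝ) :
    adCoord φ (lieExp (t • X)) =
      NormedSpace.exp (t • fderiv ℝ (fun x => adCoord φ (φ x)) 0 (toCoord φ X)) := by
  set A := fderiv ℝ (fun x => adCoord φ (φ x)) 0 (toCoord φ X) with hA
  have hd : ∀ t : ℝ, HasDerivAt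
      (fun t : ℝ => adCoord φ (lieExp (t • X)) * NormedSpace.exp (t • (-A))) 0 t := fun t => by
    have := (h.hasDerivAt_adCoord_lieExp X t).mul (hasDerivAt_exp_smul_const' (-A) t)
    refine this.congr_deriv ?_
    rw [← hA]
    simp [mul_assoc]
  have h1 := is_const_of_deriv_eq_zero (fun t => (hd t).differentiableAt) (fun t => (hd t).deriv)
    t 0
  simp only [zero_smul, lieExp_zero, h.adCoord_one, NormedSpace.exp_zero] at h1
  have h2 : NormedSpace.exp (t • (-A)) * NormedSpace.exp (t • A) = 1 := by
    let : NormedAlgebra ℚ (V →L[ℝ] V) := .restrictScalars ℚ ℝ (V →L[ℝ] V)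
    rw [← NormedSpace.exp_add_of_commute]
    · simp
    · rw [smul_neg]; exact (Commute.refl _).neg_left
  calc adCoord φ (lieExp (t • X)) = (adCoord φ (lieExp (t • X)) * NormedSpace.exp (t • (-A)))
      * NormedSpace.exp (t • A) := by rw [mul_assoc, h2, mul_one]
    _ = _ := by
      rw [h1, mul_one]
      exact one_mul _

end IsCentredChart

end

/-! ### The Maurer–Cartan form in second canonical coordinates -/

section

/-- An ordered product over `Fin n`, split at the factor with index `a`. -/
theorem prod_ofFn_split {M : Type*} [Monoid M] {n : ℕ} (f : Fin n → M) (a : Fin n) :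
    (List.ofFn f).prod = (List.ofFn fun c => if c < a then f c else 1).prod * f a *
      (List.ofFn fun c => if a < c then f c else 1).prod := by
  induction n with
  | zero => exact a.elim0
  | succ n ih =>
    refine Fin.cases ?_ (fun b => ?_) a
    · simp [List.ofFn_succ, Fin.succ_pos]
    · rw [List.ofFn_succ, List.prod_cons, ih (fun i => f i.succ) b]
      simp [List.ofFn_succ, Fin.succ_pos, mul_assoc]

theorem prod_ofFn_mul_of_commute {M : Type*} [Monoid M] {n : ℕ} (f g : Fin n → M)
    (h : ∀ i j, Commute (f i) (g j)) :
    (List.ofFn fun i => f i * g i).prod = (List.ofFn f).prod * (List.ofFn g).prod := by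
  induction n with
  | zero => simp
  | succ n ih =>
    have h1 : Commute (g 0) (List.ofFn fun i : Fin n => f i.succ).prod := by
      refine Commute.list_prod_right _ _ fun x hx => ?_
      obtain ⟨i, rfl⟩ := List.mem_ofFn.1 hx
      exact (h _ _).symm
    simp only [List.ofFn_succ, List.prod_cons]
    rw [ih _ _ fun i j => h _ _, mul_assoc, mul_assoc, ← mul_assoc (g 0), h1.eq, mul_assoc]

section
variable {ι : Type*} [Fintype ι] [DecidableEq ι]

/-- The matrix of a continuous linear endomorphism in the standard basis,
as an algebra homomorphism. -/
def toMat : ((ι → ℝ) →L[ℝ] (ι → ℝ)) →ₐ[ℝ] Matrix ι ι ℝ :=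
  (LinearMap.toMatrixAlgEquiv' : _ ≃ₐ[ℝ] Matrix ι ι ℝ).toAlgHom.comp
    { ContinuousLinearMap.toLinearMapRingHom with commutes' := fun _ => rfl }

theorem toMat_apply (T : (ι → ℝ) →L[ℝ] (ι → ℝ)) (i j : ι) :
    toMat T i j = T (Pi.single j 1) i := by
  refine (LinearMap.toMatrixAlgEquiv'_apply (T : (ι → ℝ) →ₗ[ℝ] (ι → ℝ)) i j).trans ?_
  congr 2

theorem toMat_exp (T : (ι → ℝ) →L[ℝ] (ι → ℝ)) :
    toMat (NormedSpace.exp T) = NormedSpace.exp (toMat T) := by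
  have hc : Continuous (toMat (ι := ι)) := toMat.toLinearMap.continuous_of_finiteDimensional
  rw [NormedSpace.exp_eq_tsum ℝ, NormedSpace.exp_eq_tsum ℝ]
  refine ((NormedSpace.expSeries_summable' (𝕂 := ℝ) T).hasSum.map toMat hc).tsum_eq.symm.trans ?_
  simp only [Function.comp_def, map_smul, map_pow]

end

section

variable {E : Type*} [NormedAddCommGroup E] [NormedSpace ℝ E]
  {G : Type*} [TopologicalSpace G] [ChartedSpace E G] [Group G] [LieGroup 𝓘(ℝ, E) ∞ G]
  [T2Space G] [CompleteSpace E]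

section
variable {V : Type*} [NormedAddCommGroup V] [NormedSpace ℝ V] [CompleteSpace V]
  {φ : OpenPartialHomeomorph V G}

/-- Central elements of the Lie algebra are fixed by the adjoint representation of exponentials. -/
theorem IsCentredChart.adCoord_lieExp_central (h : IsCentredChart (E := E) φ)
    {X Y : GroupLieAlgebra 𝓘(ℝ, E) G} (hX : ⁅Y, X⁆ = 0) :
    adCoord φ (lieExp Y) (toCoord φ X) = toCoord φ X := by
  have h1 := h.adCoord_lieExp Y 1
  rw [one_smul, one_smul] at h1
  set A := fderiv ℝ (fun x => adCoord φ (φ x)) 0 (toCoord φ Y) with hA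
  have hAX : A (toCoord φ X) = 0 := by
    rw [hA, ← h.toCoord_lie, hX]
    exact _root_.map_zero (toCoord φ)
  have h2 : ∀ t : ℝ, HasDerivAt (fun t : ℝ => NormedSpace.exp (t • A) (toCoord φ X)) 0 t :=
    fun t => by
      have := (hasDerivAt_exp_smul_const A t).clm_apply (hasDerivAt_const t (toCoord φ X))
      simpa [hAX] using this
  have h3 := is_const_of_deriv_eq_zero (fun t => (h2 t).differentiableAt) (fun t => (h2 t).deriv)
    1 0
  rw [h1]
  simpa using h3

theorem IsCentredChart.commute_lieExp (h : IsCentredChart (E := E) φ)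
    {X Y : GroupLieAlgebra 𝓘(ℝ, E) G} (hX : ⁅Y, X⁆ = 0) : Commute (lieExp Y) (lieExp X) := by
  have h1 := h.conj_lieExp (h.adCoord_lieExp_central hX) 1
  rw [one_smul] at h1
  exact mul_inv_eq_iff_eq_mul.1 h1

theorem IsCentredChart.adCoord_lieExp_eq_id (h : IsCentredChart (E := E) φ)
    {X : GroupLieAlgebra 𝓘(ℝ, E) G} (hX : ∀ Y : GroupLieAlgebra 𝓘(ℝ, E) G, ⁅X, Y⁆ = 0) :
    adCoord φ (lieExp X) = ContinuousLinearMap.id ℝ V := by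
  ext v
  rw [← h.toCoord_ofCoord v]
  exact h.adCoord_lieExp_central (hX _)

end

variable {r s : ℕ}

/-- The product of the factors of `complProd e u` with index larger than `a`. -/
def complTail (e : Module.Basis (Fin r ⊕ Fin s) ℝ (GroupLieAlgebra 𝓘(ℝ, E) G))
    (u : Fin s → ℝ) (a : Fin s) : G :=
  (List.ofFn fun c : Fin s => if a < c then lieExp (u c • e (Sum.inr c)) else 1).prod

variable {e : Module.Basis (Fin r ⊕ Fin s) ℝ (GroupLieAlgebra 𝓘(ℝ, E) G)}

theorem centralProd_zero : centralProd e 0 = 1 := by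
  simp [centralProd, lieExp_zero]

theorem complProd_zero : complProd e 0 = 1 := by
  simp [complProd, lieExp_zero]

/-- Changing one coordinate of `complProd` amounts to a right translation by a conjugate of a
one-parameter subgroup. -/
theorem complProd_add_single (u : Fin s → ℝ) (a : Fin s) (t : ℝ) :
    complProd e (u + Pi.single a t) = complProd e u *
      ((complTail e u a)⁻¹ * lieExp (t • e (Sum.inr a)) * complTail e u a) := by
  unfold complProd complTail
  rw [prod_ofFn_split _ a, prod_ofFn_split (fun c => lieExp (u c • e (Sum.inr c))) a]
  have h1 : ∀ c, c ≠ a → (u + (Pi.single a t : Fin s → ℝ)) c = u c := fun c hc => by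
    simp [hc]
  have h2 : (fun c => if c < a then lieExp ((u + (Pi.single a t : Fin s → ℝ)) c • e (Sum.inr c))
      else 1) = fun c => if c < a then lieExp (u c • e (Sum.inr c)) else 1 := by
    funext c
    split_ifs with hc
    · rw [h1 c hc.ne]
    · rfl
  have h3 : (fun c => if a < c then lieExp ((u + (Pi.single a t : Fin s → ℝ)) c • e (Sum.inr c))
      else 1) = fun c => if a < c then lieExp (u c • e (Sum.inr c)) else 1 := by
    funext c
    split_ifs with hc
    · rw [h1 c hc.ne']
    · rfl
  rw [h2, h3, Pi.add_apply, Pi.single_eq_same, lieExp_add_smul]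
  simp only [mul_assoc, mul_inv_cancel_left]

variable {φ : OpenPartialHomeomorph (Fin r ⊕ Fin s → ℝ) G}

theorem IsSecondCanonical.isCentredChart (hφ : IsSecondCanonical e φ) :
    IsCentredChart (E := E) φ where
  zero_mem := hφ.zero_mem
  map_zero := by
    rw [hφ.eq_prod 0 hφ.zero_mem]
    exact (congrArg₂ (· * ·) centralProd_zero complProd_zero).trans (mul_one 1)
  smooth := hφ.smooth
  smooth_symm := hφ.smooth_symm

variable (he : Submodule.span ℝ (Set.range fun μ : Fin r => e (Sum.inl μ)) =
      (LieAlgebra.center ℝ (GroupLieAlgebra 𝓘(ℝ, E) G)).toSubmodule)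

omit [T2Space G] in
include he in
theorem lie_smul_central (μ : Fin r) (c : ℝ) (Y : GroupLieAlgebra 𝓘(ℝ, E) G) :
    ⁅Y, c • e (Sum.inl μ)⁆ = 0 := by
  have h1 : e (Sum.inl μ) ∈ (LieAlgebra.center ℝ (GroupLieAlgebra 𝓘(ℝ, E) G)).toSubmodule :=
    he ▸ Submodule.subset_span ⟨μ, rfl⟩
  have h2 := (LieModule.mem_maxTrivSubmodule ℝ _ _ _).1 h1 Y
  rw [lie_smul, h2, smul_zero]

namespace IsSecondCanonical

variable (hφ : IsSecondCanonical e φ)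
include he hφ

theorem commute_lieExp_central (Y : GroupLieAlgebra 𝓘(ℝ, E) G) (μ : Fin r) (c : ℝ) :
    Commute (lieExp Y) (lieExp (c • e (Sum.inl μ))) :=
  hφ.isCentredChart.commute_lieExp (lie_smul_central he μ c Y)

theorem commute_complProd (u : Fin s → ℝ) (μ : Fin r) (c : ℝ) :
    Commute (complProd e u) (lieExp (c • e (Sum.inl μ))) := by
  refine Commute.list_prod_left _ _ fun x hx => ?_
  obtain ⟨i, rfl⟩ := List.mem_ofFn.1 hx
  exact hφ.commute_lieExp_central he _ _ _

theorem commute_complProd_centralProd (u : Fin s → ℝ) (c : Fin r → ℝ) :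
    Commute (complProd e u) (centralProd e c) := by
  refine Commute.list_prod_right _ _ fun x hx => ?_
  obtain ⟨i, rfl⟩ := List.mem_ofFn.1 hx
  exact hφ.commute_complProd he _ _ _

theorem centralProd_add (c d : Fin r → ℝ) :
    centralProd e (c + d) = centralProd e c * centralProd e d := by
  unfold centralProd
  rw [← prod_ofFn_mul_of_commute]
  · simp only [Pi.add_apply, lieExp_add_smul]
  · exact fun i j => hφ.commute_lieExp_central he _ _ _

omit he hφ in
theorem centralProd_single (μ : Fin r) (t : ℝ) :
    centralProd e (Pi.single μ t) = lieExp (t • e (Sum.inl μ)) := by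
  unfold centralProd
  rw [prod_ofFn_split _ μ]
  have h1 : ∀ c, c ≠ μ → (Pi.single μ t : Fin r → ℝ) c = 0 := fun c hc => by
    simp [hc]
  have h2 : (fun c => if c < μ then lieExp ((Pi.single μ t : Fin r → ℝ) c • e (Sum.inl c))
      else 1) = fun _ => 1 := by
    funext c
    split_ifs with hc
    · rw [h1 c hc.ne, zero_smul, lieExp_zero]
    · rfl
  have h3 : (fun c => if μ < c then lieExp ((Pi.single μ t : Fin r → ℝ) c • e (Sum.inl c))
      else 1) = fun _ => 1 := by
    funext c
    split_ifs with hc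
    · rw [h1 c hc.ne', zero_smul, lieExp_zero]
    · rfl
  rw [h2, h3, Pi.single_eq_same]
  simp

/-- Changing one coordinate of `φ x` amounts to a right translation by a conjugate of a
one-parameter subgroup. For a central coordinate the conjugation is trivial. -/
theorem inv_mul_add_single {x : Fin r ⊕ Fin s → ℝ} (hx : x ∈ φ.source) (i : Fin r ⊕ Fin s) {t : ℝ}
    (hxt : x + Pi.single i t ∈ φ.source) :
    (φ x)⁻¹ * φ (x + Pi.single i t) =
      (Sum.elim (fun _ => 1) (complTail e fun a => x (Sum.inr a)) i)⁻¹ * lieExp (t • e i) *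
        Sum.elim (fun _ => 1) (complTail e fun a => x (Sum.inr a)) i := by
  rw [hφ.eq_prod _ hx, hφ.eq_prod _ hxt, inv_mul_eq_iff_eq_mul]
  rcases i with μ | a
  · have h1 : (fun ν => (x + (Pi.single (Sum.inl μ) t : Fin r ⊕ Fin s → ℝ)) (Sum.inl ν)) =
        (fun ν => x (Sum.inl ν)) + Pi.single μ t := by
      ext ν; simp [Pi.single_apply]
    have h2 : (fun b => (x + (Pi.single (Sum.inl μ) t : Fin r ⊕ Fin s → ℝ)) (Sum.inr b)) =
        fun b => x (Sum.inr b) := by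
      ext ν; simp
    rw [h1, h2, hφ.centralProd_add he, centralProd_single]
    simp only [Sum.elim_inl, inv_one, one_mul, mul_one, mul_assoc]
    rw [(hφ.commute_complProd he _ _ _).eq]
  · have h1 : (fun ν => (x + (Pi.single (Sum.inr a) t : Fin r ⊕ Fin s → ℝ)) (Sum.inl ν)) =
        fun ν => x (Sum.inl ν) := by
      ext ν; simp
    have h2 : (fun b => (x + (Pi.single (Sum.inr a) t : Fin r ⊕ Fin s → ℝ)) (Sum.inr b)) =
        (fun b => x (Sum.inr b)) + Pi.single a t := by
      ext ν; simp [Pi.single_apply]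
    rw [h1, h2, complProd_add_single]
    simp only [Sum.elim_inr, mul_assoc]

/-- The columns of the Maurer–Cartan form are the basis elements, transformed by the adjoint
representation of the inverse of the product of the factors behind the changed one. -/
theorem leftFormCoord_single {x : Fin r ⊕ Fin s → ℝ} (hx : x ∈ φ.source) (i : Fin r ⊕ Fin s) :
    leftFormCoord φ x (Pi.single i 1) =
      adCoord φ (Sum.elim (fun _ => 1) (complTail e fun a => x (Sum.inr a)) i)⁻¹
        (toCoord φ (e i)) := by
  have h := hφ.isCentredChart
  have h1 : HasDerivAt (fun t : ℝ => x + Pi.single i t) (Pi.single i 1) 0 := by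
    have := ((hasDerivAt_id (0 : ℝ)).smul_const
      (Pi.single i (1 : ℝ) : Fin r ⊕ Fin s → ℝ)).const_add x
    simpa [← Pi.single_smul] using this
  have h0 : x + Pi.single i (0 : ℝ) = x := by simp
  have h2 : HasFDerivAt (fun y => φ.symm ((φ x)⁻¹ * φ y)) (leftFormCoord φ x)
      (x + Pi.single i (0 : ℝ)) := by
    rw [h0]; exact h.hasFDerivAt_leftFormCoord hx
  refine (h2.comp_hasDerivAt (0 : ℝ) h1).unique
    ((h.hasDerivAt_conj_lieExp _ _).congr_of_eventuallyEq ?_)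
  have := h1.continuousAt.preimage_mem_nhds (φ.open_source.mem_nhds (by rwa [h0]))
  filter_upwards [this] with t ht
  simp only [Function.comp_apply]
  rw [hφ.inv_mul_add_single he hx i ht, inv_inv]

/-- In second canonical coordinates the coordinates of the basis elements are the unit tuples. -/
theorem toCoord_basis (i : Fin r ⊕ Fin s) : toCoord φ (e i) = Pi.single i 1 := by
  have h := hφ.isCentredChart
  have h1 := hφ.leftFormCoord_single he hφ.zero_mem i
  have h2 : Sum.elim (fun _ => 1) (complTail e fun a => (0 : Fin r ⊕ Fin s → ℝ) (Sum.inr a)) i =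
      (1 : G) := by
    rcases i with μ | a
    · rfl
    · simp [complTail, lieExp_zero]
  have h3 : leftFormCoord φ 0 = ContinuousLinearMap.id ℝ _ := by
    refine (h.hasFDerivAt_leftFormCoord h.zero_mem).unique
      ((hasFDerivAt_id 0).congr_of_eventuallyEq ?_)
    filter_upwards [φ.open_source.mem_nhds h.zero_mem] with y hy
    simp [h.map_zero, φ.left_inv hy]
  rw [h2, inv_one, h.adCoord_one, h3] at h1
  exact h1.symm

theorem toCoord_eq (X : GroupLieAlgebra 𝓘(ℝ, E) G) (i : Fin r ⊕ Fin s) :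
    toCoord φ X i = e.repr X i := by
  conv_lhs => rw [← e.sum_repr X]
  rw [map_sum, Finset.sum_apply]
  simp only [map_smul, hφ.toCoord_basis he]
  simp [Pi.single_apply]

theorem toMat_fderiv_adCoord (i : Fin r ⊕ Fin s) :
    toMat (fderiv ℝ (fun x => adCoord φ (φ x)) 0 (toCoord φ (e i))) = adMatrix e i := by
  ext k j
  rw [toMat_apply, ← hφ.toCoord_basis he j, ← hφ.isCentredChart.toCoord_lie, hφ.toCoord_eq he,
    adMatrix, LinearMap.toMatrix_apply]
  rfl

end IsSecondCanonical

/-- The adjoint representation as a homomorphism to matrices, in the coordinates `φ`. -/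
def IsSecondCanonical.adMat (hφ : IsSecondCanonical e φ) :
    G →* Matrix (Fin r ⊕ Fin s) (Fin r ⊕ Fin s) ℝ where
  toFun g := toMat (adCoord φ g)
  map_one' := by
    rw [hφ.isCentredChart.adCoord_one]
    exact map_one toMat
  map_mul' g k := by
    rw [hφ.isCentredChart.adCoord_mul]
    exact map_mul toMat _ _

namespace IsSecondCanonical
variable (hφ : IsSecondCanonical e φ)
include he

theorem adMat_lieExp (i : Fin r ⊕ Fin s) (t : ℝ) :
    hφ.adMat (lieExp (t • e i)) = NormedSpace.exp (t • adMatrix e i) := by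
  change toMat _ = _
  rw [hφ.isCentredChart.adCoord_lieExp, toMat_exp, map_smul, hφ.toMat_fderiv_adCoord he]

theorem adMat_complProd (u : Fin s → ℝ) : hφ.adMat (complProd e u) = adProd e u := by
  simp only [complProd, adProd, map_list_prod, List.map_ofFn, Function.comp_def,
    hφ.adMat_lieExp he]

theorem adMat_centralProd (c : Fin r → ℝ) : hφ.adMat (centralProd e c) = 1 := by
  simp only [centralProd, map_list_prod, List.map_ofFn, Function.comp_def]
  refine List.prod_eq_one fun x hx => ?_
  obtain ⟨μ, rfl⟩ := List.mem_ofFn.1 hx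
  change toMat _ = _
  rw [hφ.isCentredChart.adCoord_lieExp_eq_id fun Y => by
    rw [← lie_skew, lie_smul_central he, neg_zero]]
  exact map_one toMat

theorem adMat_complTail_inv (u : Fin s → ℝ) (a : Fin s) :
    hφ.adMat (complTail e u a)⁻¹ = adTail e u a := by
  rw [complTail, List.prod_inv_reverse, List.map_ofFn, map_list_prod, List.map_reverse,
    List.map_ofFn, adTail]
  congr 3
  funext c
  simp only [Function.comp_apply]
  split_ifs
  · rw [← lieExp_neg, ← neg_smul, hφ.adMat_lieExp he]
  · simp

include hφ in
theorem toMat_leftFormCoord {x : Fin r ⊕ Fin s → ℝ} (hx : x ∈ φ.source) :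
    toMat (leftFormCoord φ x) = adForm e (fun a => x (Sum.inr a)) := by
  ext i k
  rw [toMat_apply, hφ.leftFormCoord_single he hx, hφ.toCoord_basis he, ← toMat_apply]
  change hφ.adMat _ i k = _
  rcases k with μ | a
  · simp [adForm]
  · rw [Sum.elim_inr, hφ.adMat_complTail_inv he]
    simp [adForm]

omit he [T2Space G] in
theorem toMat_leftCoord (x : Fin r ⊕ Fin s → ℝ) : toMat (leftCoord φ x) = leftField φ x := by
  ext i k
  rw [toMat_apply]
  rfl

include hφ in
theorem leftField_mul_adForm {x : Fin r ⊕ Fin s → ℝ} (hx : x ∈ φ.source) :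
    leftField φ x * adForm e (fun a => x (Sum.inr a)) = 1 := by
  rw [← toMat_leftCoord, ← hφ.toMat_leftFormCoord he hx, ← map_mul]
  exact (congrArg toMat (hφ.isCentredChart.leftCoord_comp_leftFormCoord hx)).trans (map_one toMat)

include hφ in
theorem isUnit_leftField {x : Fin r ⊕ Fin s → ℝ} (hx : x ∈ φ.source) :
    IsUnit (leftField φ x) :=
  .of_mul_eq_one _ (hφ.leftField_mul_adForm he hx)

include hφ in
theorem leftForm_eq {x : Fin r ⊕ Fin s → ℝ} (hx : x ∈ φ.source) :
    leftForm φ x = adForm e (fun a => x (Sum.inr a)) :=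
  Matrix.inv_eq_right_inv (hφ.leftField_mul_adForm he hx)

end IsSecondCanonical
end

end

/-! ### The composition function near the identity -/

section

/-- A map with injective strict derivative at a point of a finite-dimensional space is injective
near this point. -/
theorem exists_nhds_injOn {M N : Type*} [NormedAddCommGroup M] [NormedSpace ℝ M]
    [FiniteDimensional ℝ M] [NormedAddCommGroup N] [NormedSpace ℝ N] {f : M → N} {f' : M →L[ℝ] N}
    {x : M} (hf : HasStrictFDerivAt f f' x) (hi : Function.Injective f') :
    ∃ S ∈ 𝓝 x, InjOn f S := by
  obtain ⟨K, hK, hK'⟩ := (f' : M →ₗ[ℝ] N).exists_antilipschitzWith (LinearMap.ker_eq_bot.2 hi)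
  have hc : (0 : ℝ) < (2 * K)⁻¹ := by positivity
  have h1 := hf.isLittleO.def hc
  rw [nhds_prod_eq] at h1
  obtain ⟨S, hS, h2⟩ := Filter.mem_prod_self_iff.1 h1
  refine ⟨S, hS, fun a ha b hb hab => ?_⟩
  have h3 : ‖f a - f b - f' (a - b)‖ ≤ (2 * K : ℝ)⁻¹ * ‖a - b‖ := h2 (mk_mem_prod ha hb)
  simp only [hab, sub_self, zero_sub, norm_neg] at h3
  have h4 : ‖a - b‖ ≤ K * ‖f' (a - b)‖ := by
    simpa [dist_eq_norm] using hK'.le_mul_dist (a - b) 0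
  have h5 : ‖a - b‖ ≤ 2⁻¹ * ‖a - b‖ := by
    refine h4.trans ((mul_le_mul_of_nonneg_left h3 K.coe_nonneg).trans (le_of_eq ?_))
    have : (K : ℝ) ≠ 0 := by positivity
    field_simp
  have h6 : ‖a - b‖ = 0 := by linarith [norm_nonneg (a - b)]
  exact sub_eq_zero.1 (norm_eq_zero.1 h6)

/-- The differential of a smooth function is a smooth closed 1-form. -/
theorem isSmoothClosedOn_of_hasFDerivAt {s : ℕ} {f : (Fin s → ℝ) → ℝ}
    {α : (Fin s → ℝ) → (Fin s → ℝ) →L[ℝ] ℝ} {S : Set (Fin s → ℝ)} (hS : IsOpen S)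
    (hf : ContDiffOn ℝ ∞ f S) (hα : ∀ v ∈ S, HasFDerivAt f (α v) v) : IsSmoothClosedOn α S := by
  refine ⟨(hf.fderiv_of_isOpen hS (m := ∞) (by simp)).congr fun v hv => (hα v hv).fderiv.symm,
    fun v hv p q => ?_⟩
  have h1 : α =ᶠ[𝓝 v] fderiv ℝ f := by
    filter_upwards [hS.mem_nhds hv] with w hw using (hα w hw).fderiv.symm
  rw [h1.fderiv_eq]
  exact ((hf.contDiffAt (hS.mem_nhds hv)).isSymmSndFDerivAt
    (by simpa using ENat.LEInfty.out)) p q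

/-- The integral of an exact 1-form along a continuously differentiable path. -/
theorem curveIntegral_of_hasFDerivAt {M : Type*} [NormedAddCommGroup M] [NormedSpace ℝ M]
    {f : M → ℝ} {α : M → M →L[ℝ] ℝ} {S : Set M} (hα : ∀ v ∈ S, HasFDerivAt f (α v) v)
    (hc : ContinuousOn α S) {a b : M} (γ : Path a b) (hγ : ∀ t, γ t ∈ S)
    (hγ' : ContDiffOn ℝ 1 γ.extend (Icc 0 1)) :
    CurveIntegrable α γ ∧ curveIntegral α γ = f b - f a := by
  have hmem : ∀ t, γ.extend t ∈ S := fun t => hγ _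
  have hcont : ContinuousOn (curveIntegralFun α γ) (Icc 0 1) := by
    have h1 : ContinuousOn (fun t => α (γ.extend t)) (Icc (0 : ℝ) 1) :=
      hc.comp γ.continuous_extend.continuousOn fun t _ => hmem t
    refine (h1.clm_apply (hγ'.continuousOn_derivWithin (uniqueDiffOn_Icc zero_lt_one)
      le_rfl)).congr fun t _ => ?_
    rw [curveIntegralFun_def]
  have hint : CurveIntegrable α γ := by
    refine ContinuousOn.intervalIntegrable ?_
    rwa [uIcc_of_le zero_le_one]
  refine ⟨hint, ?_⟩
  rw [curveIntegral_def, intervalIntegral.integral_eq_sub_of_hasDerivAt_of_le zero_le_one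
    (f := fun t => f (γ.extend t)) ?_ ?_ hint]
  · simp
  · exact fun t _ => ((hα _ (hmem t)).continuousAt.comp
      γ.continuous_extend.continuousAt).continuousWithinAt
  · intro t ht
    have h1 : HasDerivAt γ.extend (derivWithin γ.extend (Icc 0 1) t) t :=
      ((hγ'.differentiableOn one_ne_zero t (Ioo_subset_Icc_self ht)).hasDerivWithinAt).hasDerivAt
        (Icc_mem_nhds ht.1 ht.2)
    rw [curveIntegralFun_def]
    exact (hα _ (hmem t)).comp_hasDerivAt t h1

theorem toMat_mulVec {ι : Type*} [Fintype ι] [DecidableEq ι] (T : (ι → ℝ) →L[ℝ] (ι → ℝ))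
    (v : ι → ℝ) : (toMat T).mulVec v = T v :=
  LinearMap.toMatrix'_mulVec (T : (ι → ℝ) →ₗ[ℝ] (ι → ℝ)) v

/-- `ofCompl` as a continuous linear map. -/
def ofComplL (r s : ℕ) : (Fin s → ℝ) →L[ℝ] (Fin r ⊕ Fin s → ℝ) :=
  ContinuousLinearMap.pi (Sum.elim (fun _ => 0) fun a => ContinuousLinearMap.proj a)

theorem ofComplL_apply {r s : ℕ} (u : Fin s → ℝ) : ofComplL r s u = ofCompl u := by
  ext i
  rcases i with μ | a <;> rfl

theorem norm_ofCompl_le {r s : ℕ} (u : Fin s → ℝ) : ‖(ofCompl u : Fin r ⊕ Fin s → ℝ)‖ ≤ ‖u‖ := by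
  refine (pi_norm_le_iff_of_nonneg (norm_nonneg u)).2 fun i => ?_
  rcases i with μ | a
  · simp [ofCompl]
  · exact norm_le_pi_norm u a

theorem ofCompl_mem_ball {r s : ℕ} {u : Fin s → ℝ} {ε : ℝ} (hu : u ∈ Metric.ball 0 ε) :
    (ofCompl u : Fin r ⊕ Fin s → ℝ) ∈ Metric.ball 0 ε := by
  rw [mem_ball_zero_iff] at hu ⊢
  exact (norm_ofCompl_le u).trans_lt hu

theorem compl_mem_ball {r s : ℕ} {x : Fin r ⊕ Fin s → ℝ} {ε : ℝ} (hx : x ∈ Metric.ball 0 ε) :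
    (fun b => x (Sum.inr b)) ∈ Metric.ball (0 : Fin s → ℝ) ε := by
  rw [mem_ball_zero_iff] at hx ⊢
  exact ((pi_norm_le_iff_of_nonneg (norm_nonneg x)).2 fun b =>
    norm_le_pi_norm x (Sum.inr b)).trans_lt hx

section

variable {E : Type*} [NormedAddCommGroup E] [NormedSpace ℝ E]
  {G : Type*} [TopologicalSpace G] [ChartedSpace E G] [Group G] [LieGroup 𝓘(ℝ, E) ∞ G]
  [T2Space G] [CompleteSpace E] {r s : ℕ}
  {e : Module.Basis (Fin r ⊕ Fin s) ℝ (GroupLieAlgebra 𝓘(ℝ, E) G)}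
  {φ : OpenPartialHomeomorph (Fin r ⊕ Fin s → ℝ) G}

namespace IsSecondCanonical

theorem apply_ofCompl (hφ : IsSecondCanonical e φ) {u : Fin s → ℝ} (hu : ofCompl u ∈ φ.source) :
    φ (ofCompl u) = complProd e u := by
  rw [hφ.eq_prod _ hu]
  exact (congrArg (· * complProd e u) centralProd_zero).trans (one_mul _)

variable (he : Submodule.span ℝ (Set.range fun μ : Fin r => e (Sum.inl μ)) =
      (LieAlgebra.center ℝ (GroupLieAlgebra 𝓘(ℝ, E) G)).toSubmodule)
  (hφ : IsSecondCanonical e φ)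
include he hφ

/-- The complement of the center acts faithfully in the adjoint representation. -/
theorem eq_zero_of_fderiv_adCoord_eq_zero {u : Fin s → ℝ}
    (hu : fderiv ℝ (fun x => adCoord φ (φ x)) 0 (ofCompl u) = 0) : u = 0 := by
  have h := hφ.isCentredChart
  set X : GroupLieAlgebra 𝓘(ℝ, E) G := ofCoord φ (ofCompl u) with hX
  have h1 : X ∈ (LieAlgebra.center ℝ (GroupLieAlgebra 𝓘(ℝ, E) G)).toSubmodule := by
    refine (LieModule.mem_maxTrivSubmodule ℝ _ _ _).2 fun Y => ?_
    have h2 : toCoord φ ⁅X, Y⁆ = 0 := by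
      rw [h.toCoord_lie, hX, h.toCoord_ofCoord, hu]
      rfl
    have h3 : ⁅X, Y⁆ = 0 := by
      rw [← h.ofCoord_toCoord ⁅X, Y⁆, h2]
      exact _root_.map_zero (ofCoord φ)
    rw [← lie_skew, h3, neg_zero]
  rw [← he] at h1
  ext a
  have h4 : e.repr X (Sum.inr a) = 0 := by
    refine Submodule.span_induction (p := fun X _ => e.repr X (Sum.inr a) = 0) ?_ ?_ ?_ ?_ h1
    · rintro _ ⟨μ, rfl⟩
      simp
    · simp
    · intro x y _ _ hx hy
      simp [hx, hy]
    · intro c x _ hx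
      simp [hx]
  rw [← hφ.toCoord_eq he, hX, h.toCoord_ofCoord] at h4
  exact h4

theorem exists_nhds_injOn_adProd : ∃ S ∈ 𝓝 (0 : Fin s → ℝ), InjOn (adProd e) S := by
  have h := hφ.isCentredChart
  have h0 : ofComplL r s 0 = 0 := _root_.map_zero _
  have h1 := h.contDiffAt_adCoord.hasStrictFDerivAt one_ne_zero
  rw [← h0] at h1
  have h2 := h1.comp (0 : Fin s → ℝ) (ofComplL r s).hasStrictFDerivAt
  obtain ⟨S, hS, hi⟩ := exists_nhds_injOn h2 (by
    refine (injective_iff_map_eq_zero _).2 fun u hu => ?_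
    rw [h0] at hu
    refine hφ.eq_zero_of_fderiv_adCoord_eq_zero he ?_
    rw [← ofComplL_apply]
    exact hu)
  have hsrc : (ofComplL r s) ⁻¹' φ.source ∈ 𝓝 0 :=
    (ofComplL r s).continuous.continuousAt.preimage_mem_nhds
      (φ.open_source.mem_nhds (by rw [h0]; exact hφ.zero_mem))
  refine ⟨S ∩ (ofComplL r s) ⁻¹' φ.source, inter_mem hS hsrc, fun u hu v hv huv => ?_⟩
  refine hi hu.1 hv.1 ?_
  have hu' : ofCompl u ∈ φ.source := ofComplL_apply u ▸ hu.2
  have hv' : ofCompl v ∈ φ.source := ofComplL_apply v ▸ hv.2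
  simp only [ofComplL_apply]
  rw [hφ.apply_ofCompl hu', hφ.apply_ofCompl hv']
  rw [← hφ.adMat_complProd he, ← hφ.adMat_complProd he] at huv
  refine ContinuousLinearMap.coe_injective (LinearMap.toMatrixAlgEquiv'.injective ?_)
  exact huv

/-- The composition function splits off the central coordinates additively. -/
theorem compFun_eq {x y : Fin r ⊕ Fin s → ℝ} (hx : x ∈ φ.source) (hy : y ∈ φ.source)
    (hx' : ofCompl (fun b => x (Sum.inr b)) ∈ φ.source)
    (hy' : ofCompl (fun b => y (Sum.inr b)) ∈ φ.source) {q : Fin r ⊕ Fin s → ℝ}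
    (hq : q = compFun φ (ofCompl fun b => x (Sum.inr b)) (ofCompl fun b => y (Sum.inr b)))
    (hxy : φ (ofCompl fun b => x (Sum.inr b)) * φ (ofCompl fun b => y (Sum.inr b)) ∈ φ.target)
    {w : Fin r ⊕ Fin s → ℝ} (hw : w = Sum.elim (fun μ => x (Sum.inl μ) + y (Sum.inl μ) +
      q (Sum.inl μ)) (fun a => q (Sum.inr a))) (hws : w ∈ φ.source) :
    φ x * φ y ∈ φ.target ∧ compFun φ x y = w := by
  have hqs : q ∈ φ.source := hq ▸ φ.map_target hxy
  have hqφ : φ q = complProd e (fun b => x (Sum.inr b)) * complProd e (fun b => y (Sum.inr b)) := by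
    rw [hq, compFun, φ.right_inv hxy, hφ.apply_ofCompl hx', hφ.apply_ofCompl hy']
  have key : φ x * φ y = φ w := by
    have h1 : (fun μ => w (Sum.inl μ)) = ((fun μ => x (Sum.inl μ)) + fun μ => y (Sum.inl μ)) +
        fun μ => q (Sum.inl μ) := by
      rw [hw]; rfl
    have h2 : (fun a => w (Sum.inr a)) = fun a => q (Sum.inr a) := by
      rw [hw]; rfl
    rw [hφ.eq_prod w hws, h1, h2, hφ.centralProd_add he, mul_assoc, ← hφ.eq_prod q hqs, hqφ,
      hφ.eq_prod x hx, hφ.eq_prod y hy, hφ.centralProd_add he]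
    simp only [mul_assoc]
    rw [← mul_assoc (complProd e _) (centralProd e _),
      (hφ.commute_complProd_centralProd he _ _).eq]
    simp only [mul_assoc]
  rw [compFun, key]
  exact ⟨φ.map_source hws, φ.left_inv hws⟩

/-- The left-invariant fields do not depend on the central coordinates. -/
theorem leftField_ofCompl {x : Fin r ⊕ Fin s → ℝ} (hx : x ∈ φ.source)
    (hx' : ofCompl (fun b => x (Sum.inr b)) ∈ φ.source) :
    leftField φ (ofCompl fun b => x (Sum.inr b)) = leftField φ x := by
  have h1 := hφ.leftField_mul_adForm he hx
  have h2 := hφ.leftField_mul_adForm he hx'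
  exact left_inv_eq_right_inv h2 (mul_eq_one_comm.1 h1)

/-- The derivative of the composition function in the complementary coordinates of its second
argument. -/
theorem hasFDerivAt_compFun {u v : Fin s → ℝ} (hv : ofCompl v ∈ φ.source)
    (huv : φ (ofCompl u) * φ (ofCompl v) ∈ φ.target) {w : Fin s → ℝ}
    (hw : w = fun a => compFun φ (ofCompl u) (ofCompl v) (Sum.inr a))
    (hws : ofCompl w ∈ φ.source) (μ : Fin r) {W : (Fin s → ℝ) → Fin s → ℝ} (hW : W v = w) :
    HasFDerivAt (fun v' => compFun φ (ofCompl u) (ofCompl v') (Sum.inl μ))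
      (quadratureForm φ W μ v) v := by
  have h := hφ.isCentredChart
  have h1 := h.hasFDerivAt_mul_right (x := ofCompl u) hv huv
  rw [← ofComplL_apply v] at h1
  have h2 := (hasFDerivAt_pi'.1 (h1.comp v (ofComplL r s).hasFDerivAt)) (Sum.inl μ)
  have h3 : (fun v' => compFun φ (ofCompl u) (ofCompl v') (Sum.inl μ)) =
      fun v' => ((fun z => φ.symm (φ (ofCompl u) * φ z)) ∘ (ofComplL r s)) v' (Sum.inl μ) := by
    funext v'
    simp only [Function.comp_apply, ofComplL_apply]
    rfl
  rw [h3]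
  refine h2.congr_fderiv ?_
  subst hw
  rw [ofComplL_apply]
  have hq : compFun φ (ofCompl u) (ofCompl v) ∈ φ.source := φ.map_target huv
  have hM : toMat ((leftCoord φ (compFun φ (ofCompl u) (ofCompl v))).comp
      (leftFormCoord φ (ofCompl v))) = leftField φ (ofCompl (W v)) * leftForm φ (ofCompl v) := by
    rw [hW, hφ.leftField_ofCompl he hq hws, hφ.leftForm_eq he hv, ← toMat_leftCoord,
      ← hφ.toMat_leftFormCoord he hv]
    exact map_mul toMat _ _
  ext dv
  have h4 := congrFun (toMat_mulVec ((leftCoord φ (compFun φ (ofCompl u) (ofCompl v))).comp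
      (leftFormCoord φ (ofCompl v))) (ofCompl dv)) (Sum.inl μ)
  rw [hM] at h4
  refine Eq.trans (congrArg (fun z => ((leftCoord φ (compFun φ (ofCompl u) (ofCompl v))).comp
      (leftFormCoord φ (ofCompl v))) z (Sum.inl μ)) (ofComplL_apply dv)) (h4.symm.trans ?_)
  simp only [Matrix.mulVec, dotProduct, Fintype.sum_sum_type, quadratureForm,
    Matrix.mul_apply, ofCompl, Sum.elim_inl, Sum.elim_inr, Pi.zero_apply, mul_zero,
    Finset.sum_const_zero, zero_add, sum_apply, smul_apply,
    ContinuousLinearMap.proj_apply, smul_eq_mul]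

omit he in
/-- A radius for which all products of elements with coordinates in the ball stay in the coordinate
neighbourhood, together with the tuples composed of their central and complementary parts. -/
theorem exists_ball {S : Set (Fin s → ℝ)} (hS : S ∈ 𝓝 0) : ∃ ε > 0,
    (∀ x ∈ Metric.ball (0 : Fin r ⊕ Fin s → ℝ) ε, x ∈ φ.source) ∧ Metric.ball 0 ε ⊆ S ∧
    ∀ x ∈ Metric.ball (0 : Fin r ⊕ Fin s → ℝ) ε, ∀ y ∈ Metric.ball (0 : Fin r ⊕ Fin s → ℝ) ε,
      φ (ofCompl fun b => x (Sum.inr b)) * φ (ofCompl fun b => y (Sum.inr b)) ∈ φ.target ∧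
      (fun a => compFun φ (ofCompl fun b => x (Sum.inr b)) (ofCompl fun b => y (Sum.inr b))
        (Sum.inr a)) ∈ S ∧
      ofCompl (fun a => compFun φ (ofCompl fun b => x (Sum.inr b))
        (ofCompl fun b => y (Sum.inr b)) (Sum.inr a)) ∈ φ.source ∧
      Sum.elim (fun μ => x (Sum.inl μ) + y (Sum.inl μ) +
        compFun φ (ofCompl fun b => x (Sum.inr b)) (ofCompl fun b => y (Sum.inr b)) (Sum.inl μ))
        (fun a => compFun φ (ofCompl fun b => x (Sum.inr b)) (ofCompl fun b => y (Sum.inr b))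
          (Sum.inr a)) ∈ φ.source := by
  have h := hφ.isCentredChart
  let V := Fin r ⊕ Fin s → ℝ
  let P : V →L[ℝ] (Fin s → ℝ) :=
    ContinuousLinearMap.pi fun b => ContinuousLinearMap.proj (Sum.inr b)
  let Q : V →L[ℝ] V := (ofComplL r s).comp P
  have hQ : ∀ x : V, (ofCompl fun b => x (Sum.inr b)) = Q x := fun x => (ofComplL_apply _).symm
  have hQl : ∀ (x : V) (μ : Fin r), Q x (Sum.inl μ) = 0 := fun x μ => rfl
  have hQr : ∀ (x : V) (a : Fin s), Q x (Sum.inr a) = x (Sum.inr a) := fun x a => rfl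
  have hQ0 : Q 0 = 0 := _root_.map_zero Q
  -- the products of the complementary parts, in coordinates
  let q : V × V → V := fun p => compFun φ (Q p.1) (Q p.2)
  have hmul : φ (Q 0) * φ (Q 0) ∈ φ.target := by simp [hQ0, h.map_zero, h.one_mem]
  have hQ0s : Q 0 ∈ φ.source := hQ0 ▸ h.zero_mem
  have hq0 : q (0, 0) = 0 := by simp [q, compFun, hQ0, h.map_zero, h.symm_one]
  have hpair : ContinuousAt (fun p : V × V => (Q p.1, Q p.2)) (0, 0) := by fun_prop
  have hq : ContinuousAt q (0, 0) :=
    ContinuousAt.comp (f := fun p : V × V => (Q p.1, Q p.2)) (x := ((0, 0) : V × V))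
      (h.contDiffAt_mul hQ0s hQ0s hmul).continuousAt hpair
  have e1 : ∀ᶠ x in 𝓝 (0 : V), x ∈ φ.source := φ.open_source.mem_nhds h.zero_mem
  have e2 : ∀ᶠ x in 𝓝 (0 : V), P x ∈ S :=
    P.continuous.continuousAt.preimage_mem_nhds (by rwa [_root_.map_zero P])
  have e3 : ∀ᶠ p in 𝓝 ((0, 0) : V × V), φ (Q p.1) * φ (Q p.2) ∈ φ.target := by
    have := topologicalGroup_of_lieGroup (G := G) 𝓘(ℝ, E) ∞
    have c1 : ContinuousAt (fun p : V × V => φ (Q p.1)) (0, 0) :=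
      ContinuousAt.comp (f := fun p : V × V => Q p.1) (x := ((0, 0) : V × V)) (g := φ)
        (φ.continuousAt hQ0s) (by fun_prop)
    have c2 : ContinuousAt (fun p : V × V => φ (Q p.2)) (0, 0) :=
      ContinuousAt.comp (f := fun p : V × V => Q p.2) (x := ((0, 0) : V × V)) (g := φ)
        (φ.continuousAt hQ0s) (by fun_prop)
    exact (c1.mul c2).preimage_mem_nhds (φ.open_target.mem_nhds hmul)
  have e4 : ∀ᶠ p in 𝓝 ((0, 0) : V × V), P (q p) ∈ S :=
    (P.continuous.continuousAt.comp hq).preimage_mem_nhds (by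
      simpa [hq0] using hS)
  have e5 : ∀ᶠ p in 𝓝 ((0, 0) : V × V), Q (q p) ∈ φ.source :=
    (Q.continuous.continuousAt.comp hq).preimage_mem_nhds (by
      simpa [hq0] using e1)
  -- `x - Q x` is the central part of `x`
  have e6 : ∀ᶠ p in 𝓝 ((0, 0) : V × V), (p.1 - Q p.1) + (p.2 - Q p.2) + q p ∈ φ.source := by
    have c1 : ContinuousAt (fun p : V × V => (p.1 - Q p.1) + (p.2 - Q p.2) + q p) (0, 0) := by
      fun_prop
    exact c1.preimage_mem_nhds (by simpa [hq0] using e1)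
  obtain ⟨ε, hε, hb⟩ := Metric.eventually_nhds_iff_ball.1 (e1.and e2)
  obtain ⟨δ, hδ, hb'⟩ := Metric.eventually_nhds_iff_ball.1 (e3.and (e4.and (e5.and e6)))
  refine ⟨min ε δ, lt_min hε hδ,
    fun x hx => (hb x (Metric.ball_subset_ball (min_le_left _ _) hx)).1,
    fun u hu => ?_, fun x hx y hy => ?_⟩
  · exact (hb _ (Metric.ball_subset_ball (min_le_left _ _) (ofCompl_mem_ball hu))).2
  · have hxy : (x, y) ∈ Metric.ball ((0, 0) : V × V) δ := by
      rw [← ball_prod_same]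
      exact ⟨Metric.ball_subset_ball (min_le_right _ _) hx,
        Metric.ball_subset_ball (min_le_right _ _) hy⟩
    obtain ⟨m3, m4, m5, m6⟩ := hb' _ hxy
    simp only [hQ]
    refine ⟨m3, m4, ?_, ?_⟩
    · exact m5
    · convert m6 using 1
      ext i
      rcases i with μ | a
      · change _ = (x (Sum.inl μ) - Q x (Sum.inl μ)) + (y (Sum.inl μ) - Q y (Sum.inl μ)) + _
        rw [hQl, hQl, sub_zero, sub_zero]
        rfl
      · change _ = (x (Sum.inr a) - Q x (Sum.inr a)) + (y (Sum.inr a) - Q y (Sum.inr a)) + _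
        rw [hQr, hQr, sub_self, sub_self, zero_add, zero_add]
        rfl

end IsSecondCanonical
end

end

end

end LocalLieGroup

open LocalLieGroup Metric in
theorem mainTheorem2
    {E : Type*} [NormedAddCommGroup E] [NormedSpace ℝ E] [FiniteDimensional ℝ E]
    {G : Type*} [TopologicalSpace G] [T2Space G] [ChartedSpace E G] [Group G]
    [LieGroup 𝓘(ℝ, E) ∞ G] {r s : ℕ}
    (e : Module.Basis (Fin r ⊕ Fin s) ℝ (GroupLieAlgebra 𝓘(ℝ, E) G))
    (he : Submodule.span ℝ (Set.range fun μ : Fin r => e (Sum.inl μ)) =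
      (LieAlgebra.center ℝ (GroupLieAlgebra 𝓘(ℝ, E) G)).toSubmodule)
    (φ : OpenPartialHomeomorph (Fin r ⊕ Fin s → ℝ) G)
    (hφ : LocalLieGroup.IsSecondCanonical e φ) :
    -- the left-invariant fields and forms are given by matrix exponentials and inversion
    (∀ x ∈ φ.source, IsUnit (LocalLieGroup.leftField φ x) ∧
      LocalLieGroup.leftForm φ x = LocalLieGroup.adForm e (fun a => x (Sum.inr a))) ∧
    ∃ (ε : ℝ) (W : Set (Fin s → ℝ))
      (Φbar : (Fin s → ℝ) → (Fin s → ℝ) → (Fin s → ℝ))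
      (Θ : (Fin s → ℝ) → (Fin s → ℝ) → (Fin r → ℝ)),
      0 < ε ∧
      -- the composition function is defined on the `ε`-ball and has the asserted form there
      (∀ x ∈ Metric.ball (0 : Fin r ⊕ Fin s → ℝ) ε, x ∈ φ.source) ∧
      (∀ x ∈ Metric.ball (0 : Fin r ⊕ Fin s → ℝ) ε,
        ∀ y ∈ Metric.ball (0 : Fin r ⊕ Fin s → ℝ) ε,
          φ x * φ y ∈ φ.target ∧
          (∀ a : Fin s, LocalLieGroup.compFun φ x y (Sum.inr a) =
            Φbar (fun b => x (Sum.inr b)) (fun b => y (Sum.inr b)) a) ∧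
          (∀ μ : Fin r, LocalLieGroup.compFun φ x y (Sum.inl μ) =
            x (Sum.inl μ) + y (Sum.inl μ) +
              Θ (fun b => x (Sum.inr b)) (fun b => y (Sum.inr b)) μ)) ∧
      ContDiffOn ℝ ∞ (fun p : (Fin s → ℝ) × (Fin s → ℝ) => Φbar p.1 p.2)
        (Metric.ball 0 ε ×ˢ Metric.ball 0 ε) ∧
      ContDiffOn ℝ ∞ (fun p : (Fin s → ℝ) × (Fin s → ℝ) => Θ p.1 p.2)
        (Metric.ball 0 ε ×ˢ Metric.ball 0 ε) ∧
      -- the matrix identity determines the complementary components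
      IsOpen W ∧ Metric.ball 0 ε ⊆ W ∧ Set.InjOn (LocalLieGroup.adProd e) W ∧
      ∀ u ∈ Metric.ball (0 : Fin s → ℝ) ε,
        (∀ v ∈ Metric.ball (0 : Fin s → ℝ) ε,
          LocalLieGroup.complProd e u * LocalLieGroup.complProd e v =
            LocalLieGroup.centralProd e (Θ u v) * LocalLieGroup.complProd e (Φbar u v) ∧
          Φbar u v ∈ W ∧
          LocalLieGroup.adProd e u * LocalLieGroup.adProd e v =
            LocalLieGroup.adProd e (Φbar u v) ∧
          LocalLieGroup.ofCompl (Φbar u v) ∈ φ.source) ∧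
        -- the central components are obtained by quadrature of a closed 1-form
        ∀ μ : Fin r,
          LocalLieGroup.IsSmoothClosedOn
            (LocalLieGroup.quadratureForm φ (Φbar u) μ) (Metric.ball 0 ε) ∧
          ∀ v ∈ Metric.ball (0 : Fin s → ℝ) ε,
            HasFDerivAt (fun v' => Θ u v' μ)
              (LocalLieGroup.quadratureForm φ (Φbar u) μ v) v ∧
            ∀ γ : Path (0 : Fin s → ℝ) v, (∀ t, γ t ∈ Metric.ball (0 : Fin s → ℝ) ε) →
              ContDiffOn ℝ 1 γ.extend (Set.Icc 0 1) →
              CurveIntegrable (LocalLieGroup.quadratureForm φ (Φbar u) μ) γ ∧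
              Θ u v μ = curveIntegral (LocalLieGroup.quadratureForm φ (Φbar u) μ) γ := by
  have : CompleteSpace E := FiniteDimensional.complete ℝ E
  have h := hφ.isCentredChart
  refine ⟨fun x hx => ⟨hφ.isUnit_leftField he hx, hφ.leftForm_eq he hx⟩, ?_⟩
  obtain ⟨S, hS, hinj⟩ := hφ.exists_nhds_injOn_adProd he
  obtain ⟨ε, hε, hsrc, hεS, hmul⟩ := hφ.exists_ball (interior_mem_nhds.2 hS)
  have hcompl : ∀ u ∈ ball (0 : Fin s → ℝ) ε, ofCompl u ∈ φ.source := fun u hu =>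
    hsrc _ (ofCompl_mem_ball hu)
  -- the estimates for the ball, for elements with vanishing central part
  have hmul' := fun u (hu : u ∈ ball (0 : Fin s → ℝ) ε) v (hv : v ∈ ball (0 : Fin s → ℝ) ε) =>
    hmul (ofCompl u) (ofCompl_mem_ball hu) (ofCompl v) (ofCompl_mem_ball hv)
  have hsmooth : ContDiffOn ℝ ∞ (fun p : (Fin s → ℝ) × (Fin s → ℝ) =>
      compFun φ (ofCompl p.1) (ofCompl p.2)) (ball 0 ε ×ˢ ball 0 ε) := by
    rintro ⟨u, v⟩ ⟨hu, hv⟩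
    have h1 : ContDiffAt ℝ ∞ (fun p : (Fin r ⊕ Fin s → ℝ) × (Fin r ⊕ Fin s → ℝ) =>
        φ.symm (φ p.1 * φ p.2)) (ofComplL r s u, ofComplL r s v) := by
      rw [ofComplL_apply, ofComplL_apply]
      exact h.contDiffAt_mul (hcompl u hu) (hcompl v hv) (hmul' u hu v hv).1
    have h2 : ContDiff ℝ ∞ (fun p : (Fin s → ℝ) × (Fin s → ℝ) =>
        (ofComplL r s p.1, ofComplL r s p.2)) := by fun_prop
    have h3 := ContDiffAt.comp (u, v) h1 h2.contDiffAt
    simp only [Function.comp_def, ofComplL_apply] at h3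
    exact h3.contDiffWithinAt
  refine ⟨ε, interior S, fun u v a => compFun φ (ofCompl u) (ofCompl v) (Sum.inr a),
    fun u v μ => compFun φ (ofCompl u) (ofCompl v) (Sum.inl μ), hε, hsrc, fun x hx y hy => ?_,
    contDiffOn_pi.2 fun a => contDiffOn_pi.1 hsmooth _,
    contDiffOn_pi.2 fun μ => contDiffOn_pi.1 hsmooth _,
    isOpen_interior, hεS, hinj.mono interior_subset, fun u hu => ⟨fun v hv => ?_, fun μ => ?_⟩⟩
  · have hcx : (ofCompl fun b => x (Sum.inr b)) ∈ φ.source := hcompl _ (compl_mem_ball hx)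
    have hcy : (ofCompl fun b => y (Sum.inr b)) ∈ φ.source := hcompl _ (compl_mem_ball hy)
    obtain ⟨m1, -, -, m4⟩ := hmul x hx y hy
    obtain ⟨h1, h2⟩ := hφ.compFun_eq he (hsrc x hx) (hsrc y hy) hcx hcy rfl m1 rfl m4
    exact ⟨h1, fun a => by rw [h2]; rfl, fun μ => by rw [h2]; rfl⟩
  · obtain ⟨m1, m2, m3, -⟩ := hmul' u hu v hv
    have key : complProd e u * complProd e v =
        centralProd e (fun μ => compFun φ (ofCompl u) (ofCompl v) (Sum.inl μ)) *
          complProd e (fun a => compFun φ (ofCompl u) (ofCompl v) (Sum.inr a)) := by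
      have m1' : φ (ofCompl u) * φ (ofCompl v) ∈ φ.target := m1
      have hprod := hφ.eq_prod (compFun φ (ofCompl u) (ofCompl v)) (φ.map_target m1')
      rw [← hprod, ← hφ.apply_ofCompl (hcompl u hu), ← hφ.apply_ofCompl (hcompl v hv)]
      exact (φ.right_inv m1).symm
    refine ⟨key, m2, ?_, m3⟩
    have h1 := congrArg hφ.adMat key
    rwa [map_mul, map_mul, hφ.adMat_complProd he, hφ.adMat_complProd he, hφ.adMat_complProd he,
      hφ.adMat_centralProd he, one_mul] at h1
  · have hα : ∀ v ∈ ball (0 : Fin s → ℝ) ε,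
        HasFDerivAt (fun v' => compFun φ (ofCompl u) (ofCompl v') (Sum.inl μ))
          (quadratureForm φ (fun v a => compFun φ (ofCompl u) (ofCompl v) (Sum.inr a)) μ v) v :=
      fun v hv => by
        obtain ⟨m1, m2, m3, -⟩ := hmul' u hu v hv
        exact hφ.hasFDerivAt_compFun he (hcompl v hv) m1 rfl m3 μ rfl
    have hs : ContDiffOn ℝ ∞ (fun v' => compFun φ (ofCompl u) (ofCompl v') (Sum.inl μ))
        (ball 0 ε) :=
      (contDiffOn_pi.1 hsmooth (Sum.inl μ)).comp (contDiffOn_const.prodMk contDiffOn_id)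
        fun v hv => ⟨hu, hv⟩
    have hclosed := isSmoothClosedOn_of_hasFDerivAt isOpen_ball hs hα
    refine ⟨hclosed, fun v hv => ⟨hα v hv, fun γ hγ hγ' => ?_⟩⟩
    obtain ⟨h1, h2⟩ := curveIntegral_of_hasFDerivAt hα hclosed.1.continuousOn γ hγ hγ'
    refine ⟨h1, ?_⟩
    -- the primitive vanishes at the origin since `exp(0) = 1`
    have h3 : compFun φ (ofCompl u) (ofCompl 0) (Sum.inl μ) = 0 := by
      have h4 : (ofCompl 0 : Fin r ⊕ Fin s → ℝ) = 0 := by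
        rw [← ofComplL_apply, map_zero]
      rw [compFun, h4, h.map_zero, mul_one, φ.left_inv (hcompl u hu)]
      rfl
    rw [h2, h3, sub_zero]
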